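/- **Setting.** Let $F$ be a commutative algebra of functions of the variables $x$, $t^{2,k}$, $t^{3,k}$ $(k\ge 0)$; precisely, any commutative $\mathbb R$-algebra with pairwise commuting $\mathbb R$-linear derivations $\partial_x,\ \partial/\partial t^{2,k},\ \partial/\partial t^{3,k}$ $(k\ge0)$, extended coefficientwise to the formal power series $F[[\varepsilon]]$. On $F[[\varepsilon]]$ put $\Lambda=e^{\varepsilon\partial_x}$, $\frac1{\Lambda+1}=\frac{1}{e^{\varepsilon\partial_x}+1}=\frac12-\frac\varepsilon4\partial_x+\cdots$, and $f^{+}=\Lambda f$. For a difference operator $X=\sum_{k\le N}a_k\Lambda^k$ (with $\Lambda\circ f=f^+\Lambda$) let $X_+=\sum_{k\ge0}a_k\Lambda^k$; for a pseudo-differential operator $X=\sum_{k\le N}a_k(\varepsilon\partial)^k$ (with $\varepsilon\partial\circ f=f\,\varepsilon\partial+\varepsilon\,\partial f$) let $X_+=\sum_{k\ge0}a_k(\varepsilon\partial)^k$. Derivatives of an operator with respect to times are taken coefficientwise. **Hypothesis.** Let $u,v,w\in F[[\varepsilon]]$ satisfy the positive flows of the rational reduction of the 2D-Toda hierarchy (RR2T)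 of type $(2,1)$: with $L=(1-w\Lambda^{-1})^{-1}(\Lambda^2+u\Lambda+v)$ and with $L^{1/2}=\Lambda+\sum_{r\ge0}c_r\Lambda^{-r}$ the square root of $L$, for all $k\ge0$, $$\varepsilon\frac{\partial L}{\partial t^{2,k}}=\frac{2^{k+\frac12}}{(2k+1)!!}\big[(L^{k+\frac12})_+,L\big],\qquad \varepsilon\frac{\partial L}{\partial t^{3,k}}=\frac1{(k+1)!}\big[(L^{k+1})_+,L\big].$$ **Conclusion.** Put $\tilde x=t^{2,0}$, $\partial_{\tilde x}=\partial/\partial t^{2,0}$, $b=\frac{1}{1+\Lambda}(u+w)$ and (subscripts $\tilde x$ denoting $\partial_{\tilde x}$) $$\begin{aligned}\tilde z^1&=\sqrt2\,w^+\big(w^+(b+b^+)+b^2-(b^+)^2+v^+\big)\\&\quad+\varepsilon\big(2b^+b^+_{\tilde x}-2bb_{\tilde x}-(b+b^+)w^+_{\tilde x}-2w^+(b+b^+)_{\tilde x}-v^+_{\tilde x}\big)+\tfrac{\varepsilon^2}{\sqrt2}(b+b^+)_{\tilde x\tilde x},\\ \tilde z^2&=w^+(b+b^+)-(b^+)^2+v^+-\tfrac{\varepsilon}{\sqrt2}\big(b^+_{\tilde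 x}+2b_{\tilde x}\big),\qquad \tilde z^3=\sqrt2\,(b+w^+).\end{aligned}$$ Then $(\tilde z^1,\tilde z^2,\tilde z^3)$ solves the constrained KP hierarchy with spatial variable $\tilde x$ and times $\tilde t^{2,k}=t^{2,k}$, $\tilde t^{3,k}=t^{3,k}$: the operator $$\tilde L=\tfrac{\varepsilon^2}{2}\partial_{\tilde x}^2+\tilde z^2+(\varepsilon\partial_{\tilde x}-\tilde z^3)^{-1}\tilde z^1$$ has a square root $\tilde L^{1/2}=\frac{1}{\sqrt2}\varepsilon\partial_{\tilde x}+\sum_{r\ge0}s_r(\varepsilon\partial_{\tilde x})^{-r}$, and for all $k\ge0$ $$\varepsilon\frac{\partial\tilde L}{\partial\tilde t^{2,k}}=\frac{2^{k+\frac12}}{(2k+1)!!}\big[(\tilde L^{k+\frac12})_+,\tilde L\big],\qquad \varepsilon\frac{\partial\tilde L}{\partial\tilde t^{3,k}}=\frac1{(k+1)!}\big[(\tilde L^{k+1})_+,\tilde L\big].$$ -/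

import Mathlib

open scoped PowerSeries Nat

noncomputable section

namespace RationalToda

/-- The independent variables: the spatial variable `x` and the times `t^{2,k}`, `t^{3,k}`. -/
inductive Var : Type
  | x : Var
  | t2 (k : ℕ) : Var
  | t3 (k : ℕ) : Var

/-! ### Functions: formal power series in `ε` over a differential algebra `F` -/

section Functions

variable {F : Type*} [CommRing F] [Algebra ℝ F]

/-- The formal parameter `ε`. -/
def eps : F⟦X⟧ := PowerSeries.X

/-- A derivation `d` of `F`, extended to `F⟦ε⟧` coefficientwise (so `ε` is a constant). -/
def deriv (d : Derivation ℝ F F) (f : F⟦X⟧) : F⟦X⟧ :=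
  PowerSeries.mk fun n => d (PowerSeries.coeff n f)

/-- The operator `p(ε d) = ∑ pᵢ εⁱ dⁱ` on `F⟦ε⟧`, for a power series `p = ∑ pᵢ Xⁱ`. -/
def applySeries (d : Derivation ℝ F F) (p : ℝ⟦X⟧) (f : F⟦X⟧) : F⟦X⟧ :=
  PowerSeries.mk fun n =>
    ∑ ij ∈ Finset.HasAntidiagonal.antidiagonal n,
      PowerSeries.coeff ij.1 p • (⇑d)^[ij.1] (PowerSeries.coeff ij.2 f)

/-- The integer powers `Λ^i = exp(i ε ∂ₓ)` of the shift operator. -/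
def shift (d : Derivation ℝ F F) (i : ℤ) (f : F⟦X⟧) : F⟦X⟧ :=
  applySeries d (PowerSeries.mk fun n => (i : ℝ) ^ n / (n ! : ℝ)) f

/-- The operator `1 / (Λ + 1) = 1 / (exp(ε ∂ₓ) + 1) = 1/2 - (ε/4) ∂ₓ + ⋯`. -/
def invShiftAddOne (d : Derivation ℝ F F) (f : F⟦X⟧) : F⟦X⟧ :=
  applySeries d (PowerSeries.exp ℝ + 1)⁻¹ f

end Functions

/-! ### Formal operators `∑_{k ≤ N} a_k θ^k`, where `θ` is `Λ` or `ε ∂_{x̃}` -/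

section Operators

/-- Sequences of coefficients `(a_k)_{k ∈ ℤ}` vanishing for all large `k`; such a sequence stands
for the formal operator `∑_k a_k θ^k`, coefficients on the left. -/
def Op (R : Type*) [CommRing R] : Submodule R (ℤ → R) where
  carrier := {a | ∃ N : ℤ, ∀ k, N < k → a k = 0}
  zero_mem' := ⟨0, fun _ _ => rfl⟩
  add_mem' := by
    rintro a b ⟨N, hN⟩ ⟨M, hM⟩
    refine ⟨max N M, fun k hk => ?_⟩
    simp [hN k (lt_of_le_of_lt (le_max_left _ _) hk), hM k (lt_of_le_of_lt (le_max_right _ _) hk)]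
  smul_mem' := by
    rintro c a ⟨N, hN⟩
    refine ⟨N, fun k hk => ?_⟩
    simp [hN k hk]

variable {R : Type*} [CommRing R]

/-- The monomial `a θ^n`. -/
def mono (n : ℤ) (a : R) : Op R :=
  ⟨fun k => if k = n then a else 0, n, fun _ hk => if_neg (ne_of_gt hk)⟩

/-- The part `X_+ = ∑_{k ≥ 0} a_k θ^k`. -/
def posPart (P : Op R) : Op R :=
  ⟨fun k => if 0 ≤ k then P.1 k else 0, by
    obtain ⟨N, hN⟩ := P.2
    exact ⟨N, fun k hk => by simp [hN k hk]⟩⟩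

/-- Powers `P^n` with respect to a given multiplication. -/
def pow (mul : Op R → Op R → Op R) (P : Op R) : ℕ → Op R
  | 0 => mono 0 1
  | n + 1 => mul (pow mul P n) P

/-- The commutator `[P, Q]` with respect to a given multiplication. -/
def comm (mul : Op R → Op R → Op R) (P Q : Op R) : Op R :=
  mul P Q - mul Q P

/-- `S = c θ + ∑_{r ≥ 0} s_r θ^{-r}` and `S² = L`. -/
def IsSqrt (mul : Op R → Op R → Op R) (c : R) (S L : Op R) : Prop :=
  S.1 1 = c ∧ (∀ k, 1 < k → S.1 k = 0) ∧ mul S S = L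

/-- Multiplication of pseudo-differential operators over a ring with a derivation `δ`; the
generator `ξ` satisfies `ξ^i a = ∑_{j ≥ 0} (i choose j) δ^j(a) ξ^{i-j}` for all `i ∈ ℤ`.
Only finitely many summands of each coefficient are non-zero. -/
def diffMul (δ : R → R) (hδ : δ 0 = 0) (P Q : Op R) : Op R :=
  ⟨fun n => ∑ᶠ ij : ℤ × ℕ,
      P.1 ij.1 * ((Ring.choose ij.1 ij.2 : ℤ) : R) * δ^[ij.2] (Q.1 (n - ij.1 + ij.2)), by
    obtain ⟨N, hN⟩ := P.2
    obtain ⟨M, hM⟩ := Q.2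
    refine ⟨N + M, fun n hn => finsum_eq_zero_of_forall_eq_zero fun ij => ?_⟩
    by_cases h : N < ij.1
    · simp [hN _ h]
    · rw [hM (n - ij.1 + ij.2) (by omega), Function.iterate_fixed hδ, mul_zero]⟩

/-- `(ξ - z)^{-1} = ∑_{n ≥ 0} q_n ξ^{-1-n}`, where `q_0 = 1` and `q_{n+1} = z q_n - δ(q_n)`. -/
def invXiSub (δ : R → R) (z : R) : Op R :=
  ⟨fun k => if k < 0 then (fun q => z * q - δ q)^[(-1 - k).toNat] 1 else 0,
    -1, fun k hk => if_neg (by omega)⟩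

theorem diffMul_invXiSub (δ : R → R) (hδ : δ 0 = 0) (z : R) :
    diffMul δ hδ (mono 1 1 - mono 0 z) (invXiSub δ z) = mono 0 1 := by
  apply Subtype.ext
  funext n
  have hs : Function.support (fun ij : ℤ × ℕ =>
      (mono 1 1 - mono 0 z : Op R).1 ij.1 * ((Ring.choose ij.1 ij.2 : ℤ) : R)
        * δ^[ij.2] ((invXiSub δ z).1 (n - ij.1 + ij.2)))
      ⊆ (({(0, 0), (1, 0), (1, 1)} : Finset (ℤ × ℕ)) : Set (ℤ × ℕ)) := by
    rintro ⟨i, j⟩ hij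
    by_contra hne
    apply hij
    simp only [Finset.coe_insert, Finset.coe_singleton, Set.mem_insert_iff, Prod.mk.injEq,
      Set.mem_singleton_iff, not_or, not_and] at hne
    by_cases h0 : i = 0
    · subst h0
      have : 0 < j := Nat.pos_of_ne_zero (hne.1 rfl)
      simp [Ring.choose_zero_pos ℤ this]
    · by_cases h1 : i = 1
      · subst h1
        have h2 : 1 < j := by
          have := hne.2.1 rfl
          have := hne.2.2 rfl
          omega
        have : (Ring.choose (1 : ℤ) j) = 0 := by
          have := Ring.choose_natCast (R := ℤ) 1 j
          rw [Nat.choose_eq_zero_of_lt h2] at this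
          simpa using this
        simp [this]
      · simp [mono, h0, h1]
  change (∑ᶠ ij : ℤ × ℕ, _) = _
  rw [finsum_eq_sum_of_support_subset _ hs]
  rw [Finset.sum_insert (by simp), Finset.sum_insert (by simp), Finset.sum_singleton]
  simp only [mono, invXiSub, AddSubgroupClass.coe_sub, Pi.sub_apply]
  rcases lt_trichotomy n 0 with h | h | h
  · obtain ⟨m, rfl⟩ : ∃ m : ℕ, n = -1 - m := ⟨(-1 - n).toNat, by omega⟩
    have e2 : (-1 - (-1 - (m : ℤ) - 1)).toNat = m + 1 := by omega
    have h0 : ¬ (-1 - (m : ℤ) = 0) := by omega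
    have h1 : -1 - (m : ℤ) < 1 := by omega
    have h2 : (-1 : ℤ) < m := by omega
    simp [h0, h1, h2, e2, Function.iterate_succ_apply', -Function.iterate_succ]
  · subst h
    simp [hδ]
  · have h1 : ¬ n < 1 := by omega
    simp [hδ, h.ne', h1, h.not_gt]

end Operators

section Hierarchies

variable {F : Type*} [CommRing F] [Algebra ℝ F]

theorem shift_zero (d : Derivation ℝ F F) (i : ℤ) : shift d i (0 : F⟦X⟧) = 0 := by
  ext n
  simp [shift, applySeries, iterate_map_zero d]

theorem eps_mul_deriv_zero (d : Derivation ℝ F F) : eps * deriv d (0 : F⟦X⟧) = 0 := by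
  have : deriv d (0 : F⟦X⟧) = 0 := by
    ext n
    simp [deriv]
  rw [this, mul_zero]

/-- Multiplication of difference operators `∑ a_k Λ^k`: here `Λ^i a = Λ^i(a) Λ^i`.
Only finitely many summands of each coefficient are non-zero. -/
def shiftMul (d : Derivation ℝ F F) (P Q : Op F⟦X⟧) : Op F⟦X⟧ :=
  ⟨fun n => ∑ᶠ i : ℤ, P.1 i * shift d i (Q.1 (n - i)), by
    obtain ⟨N, hN⟩ := P.2
    obtain ⟨M, hM⟩ := Q.2
    refine ⟨N + M, fun n hn => finsum_eq_zero_of_forall_eq_zero fun i => ?_⟩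
    by_cases h : N < i
    · simp [hN _ h]
    · rw [hM (n - i) (by omega), shift_zero, mul_zero]⟩

/-- `(1 - w Λ^{-1})^{-1} = ∑_{n ≥ 0} (w Λ^{-1})^n = ∑_{n ≥ 0} r_n Λ^{-n}`, where `r_0 = 1` and
`r_{n+1} = w Λ^{-1}(r_n)`. -/
def invOneSub (d : Derivation ℝ F F) (w : F⟦X⟧) : Op F⟦X⟧ :=
  ⟨fun k => if k ≤ 0 then (fun r => w * shift d (-1) r)^[(-k).toNat] 1 else 0,
    0, fun k hk => if_neg (by omega)⟩

theorem shiftMul_invOneSub (d : Derivation ℝ F F) (w : F⟦X⟧) :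
    shiftMul d (mono 0 1 - mono (-1) w) (invOneSub d w) = mono 0 1 := by
  have shift0 : ∀ f : F⟦X⟧, shift d 0 f = f := by
    intro f
    ext n
    simp only [shift, applySeries, PowerSeries.coeff_mk]
    rw [Finset.sum_eq_single (0, n)]
    · simp
    · rintro ⟨i, j⟩ hij hne
      have : i ≠ 0 := by
        rintro rfl
        simp at hij
        exact hne (by simp [hij])
      simp [this]
    · simp
  apply Subtype.ext
  funext n
  have hs : Function.support (fun i : ℤ =>
      (mono 0 1 - mono (-1) w : Op F⟦X⟧).1 i * shift d i ((invOneSub d w).1 (n - i)))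
      ⊆ (({0, -1} : Finset ℤ) : Set ℤ) := by
    intro i hi
    by_contra hne
    apply hi
    simp only [Finset.coe_insert, Finset.coe_singleton, Set.mem_insert_iff,
      Set.mem_singleton_iff, not_or] at hne
    simp [mono, hne.1, hne.2]
  change (∑ᶠ i : ℤ, _) = _
  rw [finsum_eq_sum_of_support_subset _ hs, Finset.sum_insert (by simp), Finset.sum_singleton]
  simp only [mono, invOneSub, AddSubgroupClass.coe_sub, Pi.sub_apply]
  rcases lt_trichotomy n 0 with h | h | h
  · obtain ⟨m, rfl⟩ : ∃ m : ℕ, n = -((m : ℤ) + 1) := ⟨(-n - 1).toNat, by omega⟩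
    have e1 : (-(-((m : ℤ) + 1) - 0)).toNat = m + 1 := by omega
    have e2 : (-(-((m : ℤ) + 1) - -1)).toNat = m := by omega
    rw [if_pos (by omega : (-((m : ℤ) + 1) - 0 ≤ 0)),
      if_pos (by omega : (-((m : ℤ) + 1) - -1 ≤ 0)), e1, e2, Function.iterate_succ_apply', shift0]
    simp
    intro hm
    omega
  · subst h
    simp [shift0, shift_zero]
  · rw [if_neg (by omega : ¬ (n - 0 ≤ 0)), if_neg (by omega : ¬ (n - -1 ≤ 0))]
    simp [shift_zero, h.ne']

/-- Coefficientwise action of a derivation on an operator. -/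
def derivOp (d : Derivation ℝ F F) (P : Op F⟦X⟧) : Op F⟦X⟧ :=
  ⟨fun k => deriv d (P.1 k), by
    obtain ⟨N, hN⟩ := P.2
    refine ⟨N, fun k hk => ?_⟩
    ext n
    simp [hN k hk, deriv]⟩

/-- The Lax equations, for all `k ≥ 0`, of an operator `L` with square root `S`:
`ε ∂L/∂t^{2,k} = 2^{k+1/2}/(2k+1)!! [(L^{k+1/2})_+, L]` with `L^{k+1/2} = S^{2k+1}`, and
`ε ∂L/∂t^{3,k} = 1/(k+1)! [(L^{k+1})_+, L]`. -/
def LaxFlows (D : Var → Derivation ℝ F F) (mul : Op F⟦X⟧ → Op F⟦X⟧ → Op F⟦X⟧)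
    (S L : Op F⟦X⟧) : Prop :=
  (∀ k : ℕ, (eps : F⟦X⟧) • derivOp (D (.t2 k)) L =
      ((2 : ℝ) ^ ((k : ℝ) + 1 / 2) / ((2 * k + 1)‼ : ℕ)) •
        comm mul (posPart (pow mul S (2 * k + 1))) L) ∧
  (∀ k : ℕ, (eps : F⟦X⟧) • derivOp (D (.t3 k)) L =
      (1 / ((k + 1)! : ℝ)) • comm mul (posPart (pow mul L (k + 1))) L)

/-- The Lax operator `L = (1 - w Λ^{-1})^{-1} (Λ² + u Λ + v)`. -/
def laxToda (d : Derivation ℝ F F) (u v w : F⟦X⟧) : Op F⟦X⟧ :=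
  shiftMul d (invOneSub d w) (mono 2 1 + mono 1 u + mono 0 v)

/-- `(u, v, w)` satisfy the `t^{2,k}`- and `t^{3,k}`-flows of the RR2T of type `(2,1)`. Here
`S = L^{1/2} = Λ + ∑_{r ≥ 0} c_r Λ^{-r}`. -/
def SolvesRR2T (D : Var → Derivation ℝ F F) (u v w : F⟦X⟧) : Prop :=
  ∃ S : Op F⟦X⟧, IsSqrt (shiftMul (D .x)) 1 S (laxToda (D .x) u v w) ∧
    LaxFlows D (shiftMul (D .x)) S (laxToda (D .x) u v w)

/-- Multiplication of pseudo-differential operators in `ξ = ε d`. -/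
def epsDiffMul (d : Derivation ℝ F F) (P Q : Op F⟦X⟧) : Op F⟦X⟧ :=
  diffMul (fun f => eps * deriv d f) (eps_mul_deriv_zero d) P Q

/-- The Lax operator `(1/2) ξ² + z² + (ξ - z³)^{-1} z¹` with `ξ = ε d`. -/
def laxCKP (d : Derivation ℝ F F) (z1 z2 z3 : F⟦X⟧) : Op F⟦X⟧ :=
  mono 2 (algebraMap ℝ F⟦X⟧ (1 / 2)) + mono 0 z2 +
    epsDiffMul d (invXiSub (fun f => eps * deriv d f) z3) (mono 0 z1)

/-- `(z¹, z², z³)` satisfy the constrained KP hierarchy with spatial variable `x̃ = t^{2,0}` and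
times `t^{2,k}`, `t^{3,k}`. Here `S = L^{1/2} = (1/√2) ε ∂_{x̃} + ∑_{r ≥ 0} s_r (ε ∂_{x̃})^{-r}`. -/
def SolvesCKP (D : Var → Derivation ℝ F F) (z1 z2 z3 : F⟦X⟧) : Prop :=
  ∃ S : Op F⟦X⟧,
    IsSqrt (epsDiffMul (D (.t2 0))) (algebraMap ℝ F⟦X⟧ (1 / √2)) S
      (laxCKP (D (.t2 0)) z1 z2 z3) ∧
    LaxFlows D (epsDiffMul (D (.t2 0))) S (laxCKP (D (.t2 0)) z1 z2 z3)

/-- `b = 1/(1+Λ) (u + w)`. -/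
def bFun (D : Var → Derivation ℝ F F) (u w : F⟦X⟧) : F⟦X⟧ :=
  invShiftAddOne (D .x) (u + w)

/-- The function `z̃¹`. -/
def zTilde1 (D : Var → Derivation ℝ F F) (u v w : F⟦X⟧) : F⟦X⟧ :=
  let b := bFun D u w
  let bp := shift (D .x) 1 b
  let vp := shift (D .x) 1 v
  let wp := shift (D .x) 1 w
  let dX : F⟦X⟧ → F⟦X⟧ := deriv (D (.t2 0))
  √2 • (wp * (wp * (b + bp) + b * b - bp * bp + vp))
    + eps * (2 * bp * dX bp - 2 * b * dX b - (b + bp) * dX wp - 2 * wp * dX (b + bp) - dX vp)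
    + (1 / √2) • (eps ^ 2 * dX (dX (b + bp)))

/-- The function `z̃²`. -/
def zTilde2 (D : Var → Derivation ℝ F F) (u v w : F⟦X⟧) : F⟦X⟧ :=
  let b := bFun D u w
  let bp := shift (D .x) 1 b
  let vp := shift (D .x) 1 v
  let wp := shift (D .x) 1 w
  let dX : F⟦X⟧ → F⟦X⟧ := deriv (D (.t2 0))
  (wp * (b + bp) - bp * bp + vp) - (1 / √2) • (eps * (dX bp + 2 * dX b))

/-- The function `z̃³`. -/
def zTilde3 (D : Var → Derivation ℝ F F) (u w : F⟦X⟧) : F⟦X⟧ :=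
  √2 • (bFun D u w + shift (D .x) 1 w)

end Hierarchies

end RationalToda

end

/-! Write ξ = ε∂_x̃ and S = L^{1/2}. The x̃-flow is generated by √2 S₊ = √2(Λ + b); that S₀ = b
follows by comparing Λ-coefficients in (1 - wΛ⁻¹)S² = Λ² + uΛ + v. Heuristically, a wave function ψ
satisfies ξψ = √2(Λ + b)ψ, so difference operators acting on ψ can be rewritten as
pseudo-differential operators in x̃. To avoid ψ, let ξ act on difference operators by X ↦ ξ(X) + √2
X(Λ + b) (`dressXi`). This action is bijective and raises the order by one, with leading factor √2.
Hence the elements ξ^k·1 form a triangular basis, and `dress`, P ↦ P·1, is a bijection from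
pseudo-differential to difference operators. It commutes with taking positive parts
(`dress_posPart`).

The map `dress` need not be multiplicative. But if Y satisfies the x̃-Lax equation, right
multiplication by Y commutes with the action of ξ, so dress(XY') = dress(X)Y whenever dress(Y') = Y
(`dress_diffMul`). This covers S, L and their powers. For another time t with generator cP, the zero
curvature equation (`zero_curvature`) says that X ↦ ε∂_t X + cXP commutes with ξ, so `dress` carries
X ↦ ε∂_t X + cXP' to it (`dress_connection`). Together these give the Lax equations for L' =
dress⁻¹(L) (`dress_lax`).

The shape of L' comes from ξ·L = √2(Λ + b)L. With z³ = √2(b + w⁺) this gives (ξ - z³)·L = √2(Λ -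
w⁺)L = √2(Λ³ + u⁺Λ² + v⁺Λ), the image of a third-order differential operator. Dividing that operator
by ξ - z³ on the left produces z² and the remainder z¹ (`dress_constrained_normal_form`,
`eq_constrained_lax`). -/

noncomputable section

namespace RationalToda

/-! ### Filtered additive maps between spaces of formal operators -/

section Filtered

variable {R : Type*} [CommRing R]

/-- The operator `P` has order at most `N`. -/
def OrdLE (N : ℤ) (P : Op R) : Prop := ∀ k, N < k → P.1 k = 0

theorem OrdLE.weaken {N M : ℤ} {P : Op R} (h : OrdLE N P) (hNM : N ≤ M) : OrdLE M P :=
  fun k hk => h k (by omega)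

theorem exists_ordLE (P : Op R) : ∃ N, OrdLE N P := P.2

theorem Op.ext_coeff {P Q : Op R} (h : ∀ k, P.1 k = Q.1 k) : P = Q :=
  Subtype.ext (funext h)

@[simp] theorem Op.coeff_add (P Q : Op R) (k : ℤ) : (P + Q).1 k = P.1 k + Q.1 k := rfl
@[simp] theorem Op.coeff_sub (P Q : Op R) (k : ℤ) : (P - Q).1 k = P.1 k - Q.1 k := rfl
@[simp] theorem Op.coeff_zero (k : ℤ) : (0 : Op R).1 k = 0 := rfl
@[simp] theorem Op.coeff_smul (a : R) (P : Op R) (k : ℤ) : (a • P).1 k = a * P.1 k := rfl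
@[simp] theorem Op.coeff_real_smul [Algebra ℝ R] (a : ℝ) (P : Op R) (k : ℤ) :
    (a • P).1 k = a • P.1 k := rfl

theorem coeff_mono (n : ℤ) (a : R) (k : ℤ) : (mono n a).1 k = if k = n then a else 0 := rfl

theorem coeff_posPart (P : Op R) (k : ℤ) : (posPart P).1 k = if 0 ≤ k then P.1 k else 0 := rfl

theorem OrdLE.add {N : ℤ} {P Q : Op R} (hP : OrdLE N P) (hQ : OrdLE N Q) : OrdLE N (P + Q) :=
  fun k hk => by simp [hP k hk, hQ k hk]

theorem OrdLE.sub {N : ℤ} {P Q : Op R} (hP : OrdLE N P) (hQ : OrdLE N Q) : OrdLE N (P - Q) :=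
  fun k hk => by simp [hP k hk, hQ k hk]

theorem ordLE_mono (n : ℤ) (a : R) : OrdLE n (mono n a) :=
  fun _ hk => if_neg (ne_of_gt hk)

theorem smul_mono (n : ℤ) (a c : R) : c • mono n a = mono n (c * a) :=
  Op.ext_coeff fun k => by simp [coeff_mono]

/-- Orders are bounded above, so killing the top coefficient repeatedly reaches every coefficient.
Uniqueness statements below reduce to a leading-coefficient computation through this lemma. -/
theorem eq_zero_of_top (P : Op R) (h : ∀ k, OrdLE k P → P.1 k = 0) : P = 0 := by
  obtain ⟨N, hN⟩ := exists_ordLE P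
  have key : ∀ m : ℕ, OrdLE (N - m) P := by
    intro m
    induction m with
    | zero => simpa using hN
    | succ m ih =>
      intro k hk
      rcases eq_or_lt_of_le (show N - m ≤ k by push_cast at hk; omega) with h1 | h1
      · rw [← h1]; exact h _ ih
      · exact ih k h1
  refine Op.ext_coeff fun k => key (N - k + 1).toNat k ?_
  omega

/-- Additive maps that raise the order by a bounded amount. -/
structure Filtered (f : Op R → Op R) : Prop where
  add : ∀ P Q, f (P + Q) = f P + f Q
  ord : ∃ c, ∀ N P, OrdLE N P → OrdLE (N + c) (f P)

theorem Filtered.comp {f g : Op R → Op R} (hf : Filtered f) (hg : Filtered g) :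
    Filtered fun P => f (g P) where
  add P Q := by rw [hg.add, hf.add]
  ord := by
    obtain ⟨c, hc⟩ := hf.ord
    obtain ⟨c', hc'⟩ := hg.ord
    exact ⟨c' + c, fun N P hP => by simpa [add_assoc] using hc _ _ (hc' _ _ hP)⟩

theorem Filtered.sub {f g : Op R → Op R} (hf : Filtered f) (hg : Filtered g) :
    Filtered fun P => f P - g P where
  add P Q := by rw [hg.add, hf.add]; abel
  ord := by
    obtain ⟨c, hc⟩ := hf.ord
    obtain ⟨c', hc'⟩ := hg.ord
    exact ⟨max c c', fun N P hP =>
      ((hc _ _ hP).weaken (by simp)).sub ((hc' _ _ hP).weaken (by simp))⟩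

theorem Filtered.sum {f g : Op R → Op R} (hf : Filtered f) (hg : Filtered g) :
    Filtered fun P => f P + g P where
  add P Q := by rw [hg.add, hf.add]; abel
  ord := by
    obtain ⟨c, hc⟩ := hf.ord
    obtain ⟨c', hc'⟩ := hg.ord
    exact ⟨max c c', fun N P hP =>
      ((hc _ _ hP).weaken (by simp)).add ((hc' _ _ hP).weaken (by simp))⟩

theorem filtered_id : Filtered (fun P : Op R => P) := ⟨fun _ _ => rfl, 0, fun N P h => by simpa⟩

theorem filtered_real_smul [Algebra ℝ R] (a : ℝ) : Filtered (fun P : Op R => a • P) :=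
  ⟨fun _ _ => smul_add _ _ _, 0, fun N P h k hk => by simp [h k (by simpa using hk)]⟩

theorem filtered_posPart : Filtered (posPart : Op R → Op R) :=
  ⟨fun P Q => Op.ext_coeff fun k => by by_cases h : 0 ≤ k <;> simp [coeff_posPart, h], 0,
    fun N P h k hk => by simp [coeff_posPart, h k (by simpa using hk)]⟩

theorem Filtered.map_zero {f : Op R → Op R} (hf : Filtered f) : f 0 = 0 := by
  have := hf.add 0 0
  simpa using this

theorem Filtered.map_sub {f : Op R → Op R} (hf : Filtered f) (P Q : Op R) :
    f (P - Q) = f P - f Q := by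
  have := hf.add (P - Q) Q
  rw [sub_add_cancel] at this
  rw [this, add_sub_cancel_right]

/-- A filtered map is determined by its values on monomials. -/
theorem Filtered.eq_zero {f : Op R → Op R} (hf : Filtered f) (h : ∀ k a, f (mono k a) = 0)
    (P : Op R) : f P = 0 := by
  obtain ⟨N, hN⟩ := exists_ordLE P
  obtain ⟨c, hc⟩ := hf.ord
  -- Stripping leading monomials, each killed by `f`, leaves `f P` unchanged but lowers the order of
  -- the argument without bound.
  have key : ∀ m : ℕ, ∃ Q, OrdLE (N - m) Q ∧ f P = f Q := by
    intro m
    induction m with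
    | zero => exact ⟨P, by simpa using hN, rfl⟩
    | succ m ih =>
      obtain ⟨Q, hQ, e⟩ := ih
      refine ⟨Q - mono (N - m) (Q.1 (N - m)), fun k hk => ?_, ?_⟩
      · push_cast at hk
        by_cases hk' : k = N - m
        · subst hk'; simp [coeff_mono]
        · simp [coeff_mono, hk', hQ k (by omega)]
      · rw [hf.map_sub, h, sub_zero, e]
  refine Op.ext_coeff fun k => ?_
  obtain ⟨Q, hQ, e⟩ := key (N + c - k + 1).toNat
  rw [e]
  exact hc _ _ hQ k (by omega)

theorem Filtered.congr_mono {f g : Op R → Op R} (hf : Filtered f) (hg : Filtered g)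
    (h : ∀ k a, f (mono k a) = g (mono k a)) (P : Op R) : f P = g P :=
  sub_eq_zero.1 ((hf.sub hg).eq_zero (fun k a => sub_eq_zero.2 (h k a)) P)

/-- An `R`-linear filtered map intertwining `θ`, with `θ (ξ^k) = ξ^{k+1}`, with an injective map
vanishes if it vanishes at `1`. -/
theorem Filtered.eq_zero_of_intertwine {f θ θ' : Op R → Op R} (hf : Filtered f)
    (hs : ∀ (a : R) P, f (a • P) = a • f P) (hθ : ∀ k, θ (mono k 1) = mono (k + 1) 1)
    (hθ' : ∀ P, θ' P = 0 ↔ P = 0) (hc : ∀ P, f (θ P) = θ' (f P)) (h0 : f (mono 0 1) = 0)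
    (P : Op R) : f P = 0 := by
  -- Triviality of the kernel of `θ'` makes this an equivalence, so vanishing at `1` spreads to
  -- negative powers too.
  have step : ∀ k, f (mono (k + 1) 1) = 0 ↔ f (mono k 1) = 0 := fun k => by
    rw [← hθ, hc, hθ']
  have all : ∀ k : ℤ, f (mono k 1) = 0 := by
    intro k
    induction k using Int.induction_on with
    | zero => exact h0
    | succ i ih => exact (step _).2 ih
    | pred i ih => exact (step _).1 (by simpa using ih)
  refine hf.eq_zero (fun k a => ?_) P
  have : mono k a = a • mono k (1 : R) := by simp [smul_mono]
  rw [this, hs, all, smul_zero]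

theorem posPart_eq_self_iff (P : Op R) : posPart P = P ↔ ∀ k < 0, P.1 k = 0 := by
  refine ⟨fun h k hk => ?_, fun h => Op.ext_coeff fun k => ?_⟩
  · rw [← h, coeff_posPart, if_neg (by omega)]
  · rw [coeff_posPart]
    split_ifs with hk
    · rfl
    · exact (h k (by omega)).symm

theorem posPart_eq_zero {P : Op R} (h : OrdLE (-1) P) : posPart P = 0 :=
  Op.ext_coeff fun k => by
    rw [coeff_posPart]
    split_ifs with hk
    · exact h k (by omega)
    · rfl

theorem posPart_of_ordLE_one {S : Op R} (hS : OrdLE 1 S) (h1 : S.1 1 = 1) :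
    posPart S = mono 1 1 + mono 0 (S.1 0) := by
  refine Op.ext_coeff fun k => ?_
  simp only [coeff_posPart, Op.coeff_add, coeff_mono]
  rcases lt_trichotomy k 0 with h | rfl | h
  · simp [h.not_ge, h.ne, show k ≠ 1 by omega]
  · simp
  · rcases eq_or_ne k 1 with rfl | hk
    · simp [h1]
    · simp [hS k (by omega), hk, h.ne']

theorem posPart_sub (P Q : Op R) : posPart (P - Q) = posPart P - posPart Q :=
  filtered_posPart.map_sub P Q

theorem ordLE_sub_posPart (P : Op R) : OrdLE (-1) (P - posPart P) := fun k hk => by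
  simp [coeff_posPart, show 0 ≤ k by omega]

/-! ### Expansion in a family of operators of controlled order -/

/-- The operator `∑ P_k E_k`, for operators `E_k` of order at most `k + c`. -/
def expand (E : ℤ → Op R) (c : ℤ) (hE : ∀ k, OrdLE (k + c) (E k)) (P : Op R) : Op R :=
  ⟨fun n => ∑ᶠ k : ℤ, P.1 k * (E k).1 n, by
    obtain ⟨N, hN⟩ := P.2
    refine ⟨N + c, fun n hn => finsum_eq_zero_of_forall_eq_zero fun k => ?_⟩
    by_cases h : N < k
    · simp [hN _ h]
    · rw [hE k n (by omega), mul_zero]⟩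

variable {E : ℤ → Op R} {c : ℤ} (hE : ∀ k, OrdLE (k + c) (E k))

theorem expand_apply {P : Op R} {N n a b : ℤ} (hP : OrdLE N P) (ha : a ≤ n - c) (hb : N ≤ b) :
    (expand E c hE P).1 n = ∑ k ∈ Finset.Icc a b, P.1 k * (E k).1 n := by
  refine finsum_eq_sum_of_support_subset _ fun k hk => ?_
  by_contra hne
  apply hk
  simp only [Finset.coe_Icc, Set.mem_Icc, not_and_or, not_le] at hne
  rcases hne with h | h
  · simp [hE k n (by omega)]
  · simp [hP k (by omega)]

theorem filtered_expand : Filtered (expand E c hE) where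
  add P Q := Op.ext_coeff fun n => by
    obtain ⟨N, hN⟩ := exists_ordLE P
    obtain ⟨M, hM⟩ := exists_ordLE Q
    have hN' := hN.weaken (le_max_left N M)
    have hM' := hM.weaken (le_max_right N M)
    rw [Op.coeff_add, expand_apply hE hN' le_rfl le_rfl, expand_apply hE hM' le_rfl le_rfl,
      expand_apply hE (hN'.add hM') le_rfl le_rfl, ← Finset.sum_add_distrib]
    simp [add_mul]
  ord := ⟨c, fun N P hP n hn => by
    rw [expand_apply hE hP le_rfl le_rfl, Finset.Icc_eq_empty (by omega), Finset.sum_empty]⟩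

theorem expand_ordLE {N : ℤ} {P : Op R} (hP : OrdLE N P) : OrdLE (N + c) (expand E c hE P) :=
  fun n hn => by
    rw [expand_apply hE hP le_rfl le_rfl, Finset.Icc_eq_empty (by omega), Finset.sum_empty]

theorem expand_smul (a : R) (P : Op R) : expand E c hE (a • P) = a • expand E c hE P := by
  refine Op.ext_coeff fun n => ?_
  obtain ⟨N, hN⟩ := exists_ordLE P
  have hN' : OrdLE N (a • P) := fun k hk => by simp [hN k hk]
  rw [Op.coeff_smul, expand_apply hE hN le_rfl le_rfl, expand_apply hE hN' le_rfl le_rfl,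
    Finset.mul_sum]
  simp [mul_assoc]

theorem expand_mono (k : ℤ) (a : R) : expand E c hE (mono k a) = a • E k := by
  refine Op.ext_coeff fun n => ?_
  change (∑ᶠ i : ℤ, _) = _
  rw [finsum_eq_single _ k (fun i hi => by simp [coeff_mono, hi])]
  simp [coeff_mono]

/-! ### Left multiplication by `ξ` and coefficientwise derivations -/

/-- The left multiplication by `ξ` in pseudo-differential operators. -/
def leftXi [Algebra ℝ R] (δ : Derivation ℝ R R) (P : Op R) : Op R :=
  ⟨fun k => δ (P.1 k) + P.1 (k - 1), by
    obtain ⟨N, hN⟩ := P.2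
    exact ⟨N + 1, fun k hk => by simp [hN k (by omega), hN (k - 1) (by omega)]⟩⟩

/-- Coefficientwise action of a derivation of `R`. -/
def opDeriv [Algebra ℝ R] (δ : Derivation ℝ R R) (P : Op R) : Op R :=
  ⟨fun k => δ (P.1 k), by
    obtain ⟨N, hN⟩ := P.2
    exact ⟨N, fun k hk => by simp [hN k hk]⟩⟩

section
variable [Algebra ℝ R] (δ : Derivation ℝ R R)

@[simp] theorem coeff_opDeriv (P : Op R) (k : ℤ) : (opDeriv δ P).1 k = δ (P.1 k) := rfl

@[simp] theorem coeff_leftXi (P : Op R) (k : ℤ) :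
    (leftXi δ P).1 k = δ (P.1 k) + P.1 (k - 1) := rfl

theorem filtered_opDeriv : Filtered (opDeriv δ) where
  add P Q := Op.ext_coeff fun k => by simp
  ord := ⟨0, fun N P h k hk => by simp [h k (by simpa using hk)]⟩

theorem filtered_leftXi : Filtered (leftXi δ) where
  add P Q := Op.ext_coeff fun k => by simp; ring
  ord := ⟨1, fun N P h k hk => by simp [h k (by omega), h (k - 1) (by omega)]⟩

theorem opDeriv_smul (a : R) (P : Op R) : opDeriv δ (a • P) = δ a • P + a • opDeriv δ P :=
  Op.ext_coeff fun k => by simp; ring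

theorem opDeriv_real_smul (a : ℝ) (P : Op R) : opDeriv δ (a • P) = a • opDeriv δ P :=
  Op.ext_coeff fun k => by simp

theorem leftXi_smul (a : R) (P : Op R) : leftXi δ (a • P) = δ a • P + a • leftXi δ P :=
  Op.ext_coeff fun k => by simp; ring

theorem leftXi_mono (k : ℤ) (a : R) : leftXi δ (mono k a) = mono k (δ a) + mono (k + 1) a := by
  refine Op.ext_coeff fun n => ?_
  simp only [coeff_leftXi, coeff_mono, Op.coeff_add, sub_eq_iff_eq_add]
  split_ifs <;> simp

theorem opDeriv_mono (k : ℤ) (a : R) : opDeriv δ (mono k a) = mono k (δ a) := by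
  refine Op.ext_coeff fun n => ?_
  simp only [coeff_opDeriv, coeff_mono]
  split_ifs <;> simp

theorem opDeriv_posPart (P : Op R) : opDeriv δ (posPart P) = posPart (opDeriv δ P) := by
  refine Op.ext_coeff fun n => ?_
  simp only [coeff_opDeriv, coeff_posPart]
  split_ifs <;> simp

theorem opDeriv_comm {δ' : Derivation ℝ R R} (h : ∀ a, δ (δ' a) = δ' (δ a)) (P : Op R) :
    opDeriv δ (opDeriv δ' P) = opDeriv δ' (opDeriv δ P) :=
  Op.ext_coeff fun _ => h _

theorem leftXi_sub_smul_injective (z : R) (P : Op R) (h : leftXi δ P - z • P = 0) : P = 0 := by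
  refine eq_zero_of_top P fun k hk => ?_
  have := congrArg (fun Q => Q.1 (k + 1)) h
  simpa [hk (k + 1) (by omega)] using this

end

end Filtered

/-! ### Pseudo-differential operators -/

section Differential

variable {R : Type*} [CommRing R] [Algebra ℝ R] (δ : Derivation ℝ R R)

/-- The product `ξ^i Q`. -/
def xiPow (i : ℤ) (Q : Op R) : Op R :=
  ⟨fun n => ∑ᶠ j : ℕ, ((Ring.choose i j : ℤ) : R) * (⇑δ)^[j] (Q.1 (n - i + j)), by
    obtain ⟨M, hM⟩ := Q.2
    refine ⟨i + M, fun n hn => finsum_eq_zero_of_forall_eq_zero fun j => ?_⟩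
    rw [hM (n - i + j) (by omega), Function.iterate_fixed (map_zero δ), mul_zero]⟩

theorem xiPow_apply {Q : Op R} {M n i : ℤ} {K : ℕ} (hQ : OrdLE M Q) (hK : M - n + i < K) :
    (xiPow δ i Q).1 n =
      ∑ j ∈ Finset.range K, ((Ring.choose i j : ℤ) : R) * (⇑δ)^[j] (Q.1 (n - i + j)) := by
  refine finsum_eq_sum_of_support_subset _ fun j hj => ?_
  by_contra hne
  apply hj
  simp only [Finset.coe_range, Set.mem_Iio, not_lt] at hne
  simp only
  rw [hQ (n - i + j) (by omega), Function.iterate_fixed (map_zero δ), mul_zero]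

theorem xiPow_ordLE {Q : Op R} {M : ℤ} (hQ : OrdLE M Q) (i : ℤ) : OrdLE (i + M) (xiPow δ i Q) :=
  fun n hn => by rw [xiPow_apply δ hQ (K := 0) (by simp; omega), Finset.sum_range_zero]

/-- For a fixed right factor the product is a filtered linear map of the left factor, so product
identities can be tested on monomials `a ξ^k`. -/
theorem diffMul_eq_expand {Q : Op R} {M : ℤ} (hQ : OrdLE M Q) (P : Op R) :
    diffMul δ (map_zero δ) P Q = expand (fun i => xiPow δ i Q) M (xiPow_ordLE δ hQ) P := by
  refine Op.ext_coeff fun n => ?_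
  obtain ⟨N, hN⟩ := exists_ordLE P
  have hs : Function.support (fun ij : ℤ × ℕ =>
      P.1 ij.1 * ((Ring.choose ij.1 ij.2 : ℤ) : R) * (⇑δ)^[ij.2] (Q.1 (n - ij.1 + ij.2)))
      ⊆ ((Finset.Icc (n - M) N ×ˢ Finset.range (M - n + N + 1).toNat : Finset (ℤ × ℕ)) :
        Set (ℤ × ℕ)) := by
    rintro ⟨i, j⟩ hij
    by_contra hne
    apply hij
    simp only [Finset.coe_product, Set.mem_prod, Finset.mem_coe, Finset.mem_Icc,
      Finset.mem_range] at hne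
    by_cases h : N < i
    · simp [hN i h]
    · simp only
      rw [hQ (n - i + j) (by omega), Function.iterate_fixed (map_zero δ), mul_zero]
  change (∑ᶠ ij : ℤ × ℕ, _) = _
  rw [finsum_eq_sum_of_support_subset _ hs, expand_apply _ hN le_rfl le_rfl, Finset.sum_product]
  refine Finset.sum_congr rfl fun i hi => ?_
  rw [Finset.mem_Icc] at hi
  rw [xiPow_apply δ hQ (K := (M - n + N + 1).toNat) (by omega), Finset.mul_sum]
  exact Finset.sum_congr rfl fun j _ => mul_assoc _ _ _

/-- Pascal's rule, valid for generalized binomial coefficients with negative upper index as well. -/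
theorem leftXi_xiPow (i : ℤ) (Q : Op R) : leftXi δ (xiPow δ i Q) = xiPow δ (i + 1) Q := by
  refine Op.ext_coeff fun n => ?_
  obtain ⟨M, hM⟩ := exists_ordLE Q
  obtain ⟨K, hK⟩ : ∃ K : ℕ, M - n + i < K := ⟨(M - n + i + 1).toNat, by omega⟩
  rw [coeff_leftXi, xiPow_apply δ hM hK,
    xiPow_apply δ hM (K := K + 1) (by push_cast; omega),
    xiPow_apply δ hM (K := K + 1) (by push_cast; omega),
    Finset.sum_range_succ', Finset.sum_range_succ' (n := K), map_sum, ← add_assoc,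
    ← Finset.sum_add_distrib]
  congr 1
  · refine Finset.sum_congr rfl fun j _ => ?_
    have h1 : n - 1 - i + ((j + 1 : ℕ) : ℤ) = n - i + j := by push_cast; ring
    have h2 : n - (i + 1) + ((j + 1 : ℕ) : ℤ) = n - i + j := by push_cast; ring
    rw [h1, h2, Ring.choose_succ_succ, Derivation.leibniz, Function.iterate_succ_apply']
    simp
    ring
  · simp [show n - (i + 1) = n - 1 - i by ring]

theorem filtered_diffMul (Q : Op R) : Filtered fun P => diffMul δ (map_zero δ) P Q := by
  obtain ⟨M, hM⟩ := exists_ordLE Q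
  simp only [diffMul_eq_expand δ hM]
  exact filtered_expand _

theorem smul_diffMul (a : R) (P Q : Op R) :
    diffMul δ (map_zero δ) (a • P) Q = a • diffMul δ (map_zero δ) P Q := by
  obtain ⟨M, hM⟩ := exists_ordLE Q
  simp only [diffMul_eq_expand δ hM]
  exact expand_smul _ _ _

theorem mono_diffMul (k : ℤ) (a : R) (Q : Op R) :
    diffMul δ (map_zero δ) (mono k a) Q = a • xiPow δ k Q := by
  obtain ⟨M, hM⟩ := exists_ordLE Q
  rw [diffMul_eq_expand δ hM, expand_mono]

theorem one_diffMul (Q : Op R) : diffMul δ (map_zero δ) (mono 0 1) Q = Q := by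
  rw [mono_diffMul, one_smul]
  refine Op.ext_coeff fun n => ?_
  change (∑ᶠ j : ℕ, _) = _
  rw [finsum_eq_single _ 0]
  · simp
  · intro j hj
    simp [Ring.choose_zero_pos ℤ (Nat.pos_of_ne_zero hj)]

/-- The only case of associativity of the pseudo-differential product that is needed; the rest is
inherited from difference operators through `dress`. -/
theorem leftXi_diffMul (P Q : Op R) :
    diffMul δ (map_zero δ) (leftXi δ P) Q = leftXi δ (diffMul δ (map_zero δ) P Q) := by
  refine Filtered.congr_mono ((filtered_diffMul δ Q).comp (filtered_leftXi δ))
    ((filtered_leftXi δ).comp (filtered_diffMul δ Q)) (fun k a => ?_) P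
  simp only [leftXi_mono, (filtered_diffMul δ Q).add, mono_diffMul, leftXi_smul, leftXi_xiPow]

theorem leftXi_eq_diffMul (P : Op R) : diffMul δ (map_zero δ) (mono 1 1) P = leftXi δ P := by
  have : mono 1 (1 : R) = leftXi δ (mono 0 1) := by
    rw [leftXi_mono]
    refine Op.ext_coeff fun n => ?_
    simp [coeff_mono]
  rw [this, leftXi_diffMul, one_diffMul]

theorem leftXi_invXiSub (z : R) :
    leftXi δ (invXiSub δ z) - z • invXiSub δ z = mono 0 1 := by
  have h := diffMul_invXiSub δ (map_zero δ) z
  rw [(filtered_diffMul δ _).map_sub, leftXi_eq_diffMul] at h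
  have hz : mono 0 z = z • mono 0 (1 : R) := by simp [smul_mono]
  rwa [hz, smul_diffMul, one_diffMul] at h

theorem leftXi_invXiSub_diffMul (z : R) (Q : Op R) :
    leftXi δ (diffMul δ (map_zero δ) (invXiSub δ z) Q) -
      z • diffMul δ (map_zero δ) (invXiSub δ z) Q = Q := by
  rw [← leftXi_diffMul, ← smul_diffMul, ← (filtered_diffMul δ Q).map_sub, leftXi_invXiSub,
    one_diffMul]

end Differential

/-! ### The ring of difference operators -/

section Difference

variable {R : Type*} [CommRing R] [Algebra ℝ R] (σ : R ≃ₐ[ℝ] R)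

/-- The product `Λ^i Q`. -/
def lamPow (i : ℤ) (Q : Op R) : Op R :=
  ⟨fun n => (σ ^ i) (Q.1 (n - i)), by
    obtain ⟨M, hM⟩ := Q.2
    exact ⟨i + M, fun n hn => by simp [hM (n - i) (by omega)]⟩⟩

theorem lamPow_ordLE {Q : Op R} {M : ℤ} (hQ : OrdLE M Q) (i : ℤ) : OrdLE (i + M) (lamPow σ i Q) :=
  fun n hn => by
    change (σ ^ i) (Q.1 (n - i)) = 0
    rw [hQ (n - i) (by omega), map_zero]

/-- Multiplication of difference operators over a ring with an automorphism `σ`. -/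
def lamMul (P Q : Op R) : Op R :=
  ⟨fun n => ∑ᶠ i : ℤ, P.1 i * (σ ^ i) (Q.1 (n - i)), by
    obtain ⟨M, hM⟩ := Q.2
    exact (expand (fun i => lamPow σ i Q) M (lamPow_ordLE σ hM) P).2⟩

theorem lamMul_eq_expand {Q : Op R} {M : ℤ} (hQ : OrdLE M Q) (P : Op R) :
    lamMul σ P Q = expand (fun i => lamPow σ i Q) M (lamPow_ordLE σ hQ) P := rfl

theorem filtered_lamMul (Q : Op R) : Filtered fun P => lamMul σ P Q := by
  obtain ⟨M, hM⟩ := exists_ordLE Q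
  simp only [lamMul_eq_expand σ hM]
  exact filtered_expand _

theorem filtered_lamPow (k : ℤ) : Filtered (lamPow σ k) where
  add P Q := Op.ext_coeff fun n => map_add _ _ _
  ord := ⟨k, fun N P h => by rw [add_comm]; exact lamPow_ordLE σ h k⟩

theorem smul_lamMul (a : R) (P Q : Op R) :
    lamMul σ (a • P) Q = a • lamMul σ P Q := by
  obtain ⟨M, hM⟩ := exists_ordLE Q
  simp only [lamMul_eq_expand σ hM]
  exact expand_smul _ _ _

theorem mono_lamMul (k : ℤ) (a : R) (Q : Op R) :
    lamMul σ (mono k a) Q = a • lamPow σ k Q := by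
  obtain ⟨M, hM⟩ := exists_ordLE Q
  rw [lamMul_eq_expand σ hM, expand_mono]

theorem coeff_mono_lamMul (k : ℤ) (a : R) (Q : Op R) (n : ℤ) :
    (lamMul σ (mono k a) Q).1 n = a * (σ ^ k) (Q.1 (n - k)) := by
  rw [mono_lamMul]; rfl

theorem mono_lamMul_mono (k j : ℤ) (a c : R) :
    lamMul σ (mono k a) (mono j c) = mono (k + j) (a * (σ ^ k) c) := by
  refine Op.ext_coeff fun n => ?_
  simp only [coeff_mono_lamMul, coeff_mono, sub_eq_iff_eq_add, add_comm j]
  split_ifs <;> simp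

theorem OrdLE.lamMul {N M : ℤ} {P Q : Op R} (hP : OrdLE N P) (hQ : OrdLE M Q) :
    OrdLE (N + M) (lamMul σ P Q) := by
  rw [lamMul_eq_expand σ hQ]
  exact expand_ordLE _ hP

theorem coeff_lamMul_top {N M : ℤ} {P Q : Op R} (hP : OrdLE N P) (hQ : OrdLE M Q) :
    (lamMul σ P Q).1 (N + M) = P.1 N * (σ ^ N) (Q.1 M) := by
  rw [lamMul_eq_expand σ hQ, expand_apply _ hP (a := N) (by omega) le_rfl, Finset.Icc_self,
    Finset.sum_singleton]
  change P.1 N * (σ ^ N) (Q.1 (N + M - N)) = _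
  rw [add_sub_cancel_left]

theorem coeff_lamMul_second {P Q : Op R} (hP : OrdLE 1 P) (hQ : OrdLE 1 Q) :
    (lamMul σ P Q).1 1 = P.1 0 * Q.1 1 + P.1 1 * σ (Q.1 0) := by
  rw [lamMul_eq_expand σ hQ, expand_apply _ hP (a := 0) (by omega) le_rfl,
    show Finset.Icc (0 : ℤ) 1 = {0, 1} from rfl, Finset.sum_pair (by norm_num)]
  rfl

theorem lamPow_lamMul (k : ℤ) (P Q : Op R) :
    lamMul σ (lamPow σ k P) Q = lamPow σ k (lamMul σ P Q) := by
  refine Filtered.congr_mono ((filtered_lamMul σ Q).comp (filtered_lamPow σ k))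
    ((filtered_lamPow σ k).comp (filtered_lamMul σ Q)) (fun j a => ?_) P
  have h : lamPow σ k (mono j a) = mono (k + j) ((σ ^ k) a) := by
    have := mono_lamMul_mono σ k j 1 a
    rwa [mono_lamMul, one_smul, one_mul] at this
  rw [h]
  refine Op.ext_coeff fun n => ?_
  change _ = (σ ^ k) ((lamMul σ (mono j a) Q).1 (n - k))
  rw [coeff_mono_lamMul, coeff_mono_lamMul, map_mul, zpow_add, AlgEquiv.mul_apply,
    sub_sub]

theorem lamMul_assoc (P Q S : Op R) :
    lamMul σ (lamMul σ P Q) S = lamMul σ P (lamMul σ Q S) := by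
  refine Filtered.congr_mono ((filtered_lamMul σ S).comp (filtered_lamMul σ Q))
    (filtered_lamMul σ _) (fun k a => ?_) P
  rw [mono_lamMul, mono_lamMul, smul_lamMul, lamPow_lamMul]

theorem lamMul_add (P Q S : Op R) :
    lamMul σ P (Q + S) = lamMul σ P Q + lamMul σ P S := by
  refine Filtered.congr_mono (filtered_lamMul σ _)
    ((filtered_lamMul σ Q).sum (filtered_lamMul σ S)) (fun k a => ?_) P
  rw [mono_lamMul, mono_lamMul, mono_lamMul, (filtered_lamPow σ k).add, smul_add]

theorem real_smul_lamMul (c : ℝ) (P Q : Op R) :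
    lamMul σ (c • P) Q = c • lamMul σ P Q := by
  have h : ∀ P : Op R, c • P = algebraMap ℝ R c • P := fun P =>
    Op.ext_coeff fun k => by simp [Algebra.smul_def]
  rw [h, h, smul_lamMul]

theorem lamMul_real_smul (c : ℝ) (P Q : Op R) :
    lamMul σ P (c • Q) = c • lamMul σ P Q := by
  refine Filtered.congr_mono (filtered_lamMul σ _)
    ((filtered_real_smul c).comp (filtered_lamMul σ Q)) (fun k a => ?_) P
  refine Op.ext_coeff fun n => ?_
  rw [Op.coeff_real_smul, coeff_mono_lamMul, coeff_mono_lamMul, Op.coeff_real_smul,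
    map_smul, mul_smul_comm]

theorem one_lamMul (P : Op R) : lamMul σ (mono 0 1) P = P :=
  Op.ext_coeff fun n => by simp [coeff_mono_lamMul]

theorem lamMul_one (P : Op R) : lamMul σ P (mono 0 1) = P :=
  Filtered.congr_mono (filtered_lamMul σ _) filtered_id
    (fun k a => by simp [mono_lamMul_mono]) P

theorem opDeriv_lamMul (δ : Derivation ℝ R R) (hδ : ∀ a, δ (σ a) = σ (δ a)) (P Q : Op R) :
    opDeriv δ (lamMul σ P Q) =
      lamMul σ (opDeriv δ P) Q + lamMul σ P (opDeriv δ Q) := by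
  have hz : ∀ (k : ℤ) a, δ ((σ ^ k) a) = (σ ^ k) (δ a) := by
    intro k
    induction k using Int.induction_on with
    | zero => simp
    | succ i ih => intro a; rw [zpow_add_one, AlgEquiv.mul_apply, ih, hδ]; rfl
    | pred i ih =>
      intro a
      rw [zpow_sub_one, AlgEquiv.mul_apply, ih, AlgEquiv.mul_apply]
      congr 1
      apply σ.injective
      rw [← hδ]
      change δ (σ (σ.symm a)) = σ (σ.symm (δ a))
      simp
  refine Filtered.congr_mono ((filtered_opDeriv δ).comp (filtered_lamMul σ Q))
    (((filtered_lamMul σ Q).comp (filtered_opDeriv δ)).sum (filtered_lamMul σ _))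
    (fun k a => ?_) P
  refine Op.ext_coeff fun n => ?_
  simp only [opDeriv_mono, Op.coeff_add, coeff_opDeriv, coeff_mono_lamMul, Derivation.leibniz,
    hz, smul_eq_mul]
  ring

/-- The ring of difference operators. -/
abbrev differenceRing : Ring (Op R) :=
  { (inferInstance : AddCommGroup (Op R)) with
    mul := lamMul σ
    one := mono 0 1
    mul_assoc := lamMul_assoc σ
    one_mul := one_lamMul σ
    mul_one := lamMul_one σ
    left_distrib := lamMul_add σ
    right_distrib := fun P Q S => (filtered_lamMul σ S).add P Q
    zero_mul := fun P => (filtered_lamMul σ P).map_zero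
    mul_zero := fun P => by
      have := lamMul_add σ P 0 0
      rw [add_zero] at this
      exact left_eq_add.1 this }

theorem lamMul_sub (P Q S : Op R) :
    lamMul σ P (Q - S) = lamMul σ P Q - lamMul σ P S := by
  let := differenceRing σ
  exact mul_sub P Q S

theorem pow_eq_npow (P : Op R) (n : ℕ) :
    pow (lamMul σ) P n = (differenceRing σ).npow n P := by
  let := differenceRing σ
  change _ = P ^ n
  induction n with
  | zero => rw [pow_zero]; rfl
  | succ n ih => rw [pow_succ, ← ih]; rfl

theorem pow_mul_comm_self (P : Op R) (n : ℕ) :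
    lamMul σ (pow (lamMul σ) P n) P = lamMul σ P (pow (lamMul σ) P n) := by
  rw [pow_eq_npow]
  let := differenceRing σ
  exact (pow_mul_comm' P n)

theorem pow_sq (P : Op R) (n : ℕ) :
    pow (lamMul σ) (lamMul σ P P) n = pow (lamMul σ) P (2 * n) := by
  rw [pow_eq_npow, pow_eq_npow]
  let := differenceRing σ
  change (P * P) ^ n = P ^ (2 * n)
  rw [pow_mul, sq]

end Difference

/-! ### Identities in a ring of operators -/

section RingIdentities

/-- Expand `[T - P, S - p]` and use `[T, S] = 0`. With `P`, `p` the positive parts, the last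
commutator has negative order. -/
theorem commutator_truncations {A : Type*} [Ring A] {S T P p : A} (h : T * S = S * T) :
    (P * S - S * P) - (p * T - T * p) =
      (P * p - p * P) - ((T - P) * (S - p) - (S - p) * (T - P)) := by
  simp only [sub_mul, mul_sub, h]
  abel

variable {A : Type*} [Ring A] [Module ℝ A] [SMulCommClass ℝ A A] [IsScalarTower ℝ A A]

/-- The defect of the Lax equation for `S` anticommutes with `S` as soon as `S²` satisfies the
equation; a leading-coefficient argument then kills it. -/
theorem anticommutator_defect {c : ℝ} {S P S' : A}
    (h : S' * S + S * S' = c • (P * (S * S) - S * S * P)) :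
    (S' - c • (P * S - S * P)) * S + S * (S' - c • (P * S - S * P)) = 0 := by
  have : (S' - c • (P * S - S * P)) * S + S * (S' - c • (P * S - S * P)) =
      S' * S + S * S' - c • (P * (S * S) - S * S * P) := by
    simp only [sub_mul, mul_sub, smul_mul_assoc, mul_smul_comm, smul_sub, mul_assoc]
    abel
  rw [this, h, sub_self]

theorem derivation_pow {c : ℝ} {S P : A} (d : A → A) (h1 : d 1 = 0)
    (hd : ∀ X Y, d (X * Y) = d X * Y + X * d Y) (h : d S = c • (P * S - S * P)) (n : ℕ) :
    d (S ^ n) = c • (P * S ^ n - S ^ n * P) := by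
  induction n with
  | zero => simp [h1]
  | succ n ih =>
    rw [pow_succ, hd, ih, h]
    simp only [sub_mul, mul_sub, smul_mul_assoc, mul_smul_comm, smul_sub, mul_assoc]
    abel

/-- The two sides are the two orders of composing the connections `∂ₓ + s·(right mult. by p)` and
`∂ₜ + c·(right mult. by P)`. They differ by right multiplication by the curvature, which `h` makes
zero. -/
theorem commuting_connections {X p P p' P' Xt Xx Xtx : A} {s c : ℝ}
    (h : s • p' - c • P' = (s * c) • (P * p - p * P)) :
    (Xtx + s • (Xt * p + X * p')) + c • ((Xx + s • (X * p)) * P) =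
      (Xtx + c • (Xx * P + X * P')) + s • ((Xt + c • (X * P)) * p) := by
  have h2 : X * (s • p') = X * (c • P') + X * ((s * c) • (P * p - p * P)) := by
    rw [← h]; simp only [mul_sub]; abel
  simp only [add_mul, mul_sub, smul_mul_assoc, mul_smul_comm, smul_sub, smul_add, mul_assoc,
    smul_smul, mul_comm c s] at h2 ⊢
  rw [h2]
  abel

end RingIdentities

/-! ### The action of `ξ` on difference operators and the dressing isomorphism -/

section Triangular

variable {R : Type*} [CommRing R]

/-- Unitriangular systems are solved recursively. -/
def triangularSolve (a : ℕ → ℕ → R) (dinv y : ℕ → R) : ℕ → R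
  | m => dinv m * (y m - ∑ j : Fin m, triangularSolve a dinv y j * a j m)
  decreasing_by exact j.2

theorem triangularSolve_spec (a : ℕ → ℕ → R) (dinv y : ℕ → R) (h : ∀ m, a m m * dinv m = 1)
    (m : ℕ) : ∑ j ∈ Finset.range (m + 1), triangularSolve a dinv y j * a j m = y m := by
  rw [Finset.sum_range_succ, triangularSolve,
    Finset.sum_range (fun j => triangularSolve a dinv y j * a j m), mul_right_comm,
    mul_comm (dinv m), h]
  ring

variable {E : ℤ → Op R} (hE : ∀ k, OrdLE (k + 0) (E k))

theorem coeff_expand_top {k : ℤ} {P : Op R} (hP : OrdLE k P) :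
    (expand E 0 hE P).1 k = P.1 k * (E k).1 k := by
  rw [expand_apply hE hP (a := k) (by omega) le_rfl, Finset.Icc_self, Finset.sum_singleton]

theorem expand_injective (hu : ∀ k, IsUnit ((E k).1 k)) (P : Op R)
    (h : expand E 0 hE P = 0) : P = 0 := by
  refine eq_zero_of_top P fun k hk => ?_
  have := coeff_expand_top hE hk
  rw [h, Op.coeff_zero] at this
  exact (hu k).mul_left_eq_zero.1 this.symm

/-- Numbering coefficients downwards from `N` turns the equation into a triangular system with unit
diagonal entries. -/
theorem exists_expand_eq (hu : ∀ k, IsUnit ((E k).1 k)) {N : ℤ} {Q : Op R} (hQ : OrdLE N Q) :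
    ∃ P, OrdLE N P ∧ expand E 0 hE P = Q := by
  choose u hu using hu
  let x := triangularSolve (fun j m => (E (N - j)).1 (N - m)) (fun m => ((u (N - m))⁻¹ : Rˣ))
    (fun m => Q.1 (N - m))
  have hx := triangularSolve_spec (fun j m => (E (N - j)).1 (N - m))
    (fun m => ((u (N - m))⁻¹ : Rˣ)) (fun m => Q.1 (N - m)) (fun m => by rw [← hu]; simp)
  let P : Op R := ⟨fun k => if k ≤ N then x (N - k).toNat else 0, N,
    fun k hk => if_neg (by omega)⟩
  have hP : OrdLE N P := fun k hk => if_neg (by omega)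
  refine ⟨P, hP, Op.ext_coeff fun n => ?_⟩
  by_cases hn : N < n
  · rw [hQ n hn]
    exact expand_ordLE hE hP n (by omega)
  · obtain ⟨m, rfl⟩ : ∃ m : ℕ, n = N - m := ⟨(N - n).toNat, by omega⟩
    rw [expand_apply hE hP (a := N - m) (by omega) le_rfl, ← hx m]
    refine Finset.sum_nbij' (fun k => (N - k).toNat) (fun j => N - j) ?_ ?_ ?_ ?_ ?_
    · intro k hk; simp only [Finset.mem_Icc] at hk; simp; omega
    · intro j hj; simp only [Finset.mem_range] at hj; simp; omega
    · intro k hk; simp only [Finset.mem_Icc] at hk; omega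
    · intro j hj; omega
    · intro k hk
      simp only [Finset.mem_Icc] at hk
      simp [P, hk.2, x]

end Triangular

section Dressing

variable {R : Type*} [CommRing R] [Algebra ℝ R]

variable (σ : R ≃ₐ[ℝ] R) (δ : Derivation ℝ R R) (b : R)

/-- The action `X ↦ δ(X) + √2 X (Λ + b)` of `ξ` on difference operators. -/
def dressXi (P : Op R) : Op R :=
  ⟨fun k => δ (P.1 k) + √2 • (P.1 (k - 1) + P.1 k * (σ ^ k) b), by
    obtain ⟨N, hN⟩ := P.2
    exact ⟨N + 1, fun k hk => by simp [hN k (by omega), hN (k - 1) (by omega)]⟩⟩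

theorem coeff_dressXi (P : Op R) (k : ℤ) :
    (dressXi σ δ b P).1 k = δ (P.1 k) + √2 • (P.1 (k - 1) + P.1 k * (σ ^ k) b) := rfl

theorem filtered_dressXi : Filtered (dressXi σ δ b) where
  add P Q := Op.ext_coeff fun k => by
    simp only [coeff_dressXi, Op.coeff_add, map_add, add_mul, smul_add]; abel
  ord := ⟨1, fun N P h k hk => by
    simp [coeff_dressXi, h k (by omega), h (k - 1) (by omega)]⟩

theorem dressXi_smul (a : R) (P : Op R) :
    dressXi σ δ b (a • P) = δ a • P + a • dressXi σ δ b P :=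
  Op.ext_coeff fun k => by
    simp only [coeff_dressXi, Op.coeff_add, Op.coeff_smul, Derivation.leibniz, smul_eq_mul,
      Algebra.smul_def]
    ring

theorem dressXi_eq (P : Op R) :
    dressXi σ δ b P = opDeriv δ P + √2 • lamMul σ P (mono 1 1 + mono 0 b) := by
  refine Filtered.congr_mono (filtered_dressXi σ δ b) ((filtered_opDeriv δ).sum
    ((filtered_real_smul √2).comp (filtered_lamMul σ _))) (fun k a => ?_) P
  refine Op.ext_coeff fun n => ?_
  rw [lamMul_add, mono_lamMul_mono, mono_lamMul_mono, opDeriv_mono]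
  simp only [coeff_dressXi, Op.coeff_add, Op.coeff_real_smul, coeff_mono, map_one, mul_one,
    add_zero, sub_eq_iff_eq_add]
  by_cases h : n = k <;> simp [h]

theorem smul_sqrt_two_eq_zero {a : R} (h : √2 • a = 0) : a = 0 := by
  have h2 : √2 ≠ 0 := by positivity
  simpa [smul_smul, h2] using congrArg (fun x => (√2)⁻¹ • x) h

theorem dressXi_eq_zero_iff (P : Op R) : dressXi σ δ b P = 0 ↔ P = 0 := by
  refine ⟨fun h => eq_zero_of_top P fun k hk => ?_,
    fun h => h ▸ (filtered_dressXi σ δ b).map_zero⟩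
  have := congrArg (fun Q => Q.1 (k + 1)) h
  simp only [coeff_dressXi, hk (k + 1) (by omega), map_zero, zero_mul, add_zero, zero_add,
    add_sub_cancel_right, Op.coeff_zero] at this
  exact smul_sqrt_two_eq_zero this

theorem exists_dressXi_eq {N : ℤ} {Q : Op R} (hQ : OrdLE (N + 1) Q) :
    ∃ P, OrdLE N P ∧ dressXi σ δ b P = Q := by
  -- let x : ℕ → R The coefficient of `Λ^k` in the equation determines `P_{k-1}` from `P_k`, since
  -- `√2` is invertible; `x m` is the coefficient `P_{N-m}`.
  have h2 : √2 ≠ 0 := by positivity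
  let x : ℕ → R := fun m => Nat.rec ((√2)⁻¹ • Q.1 (N + 1))
    (fun m y => (√2)⁻¹ • (Q.1 (N - m) - δ y) - y * (σ ^ (N - m)) b) m
  let P : Op R := ⟨fun k => if k ≤ N then x (N - k).toNat else 0, N,
    fun k hk => if_neg (by omega)⟩
  have hP : OrdLE N P := fun k hk => if_neg (by omega)
  have hPx : ∀ m : ℕ, P.1 (N - m) = x m := fun m => by simp [P]
  refine ⟨P, hP, Op.ext_coeff fun k => ?_⟩
  rw [coeff_dressXi]
  rcases lt_trichotomy k (N + 1) with h | h | h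
  · obtain ⟨m, rfl⟩ : ∃ m : ℕ, k = N - m := ⟨(N - k).toNat, by omega⟩
    have e : N - (m : ℤ) - 1 = N - (m + 1 : ℕ) := by push_cast; ring
    rw [e, hPx, hPx]
    change _ + √2 • ((√2)⁻¹ • (Q.1 (N - m) - δ (x m)) - x m * (σ ^ (N - m)) b + _) = _
    rw [sub_add_cancel, smul_smul, mul_inv_cancel₀ h2, one_smul, add_sub_cancel]
  · subst h
    rw [hP (N + 1) (by omega), add_sub_cancel_right, ← sub_zero N]
    have := hPx 0
    simp only [Nat.cast_zero] at this
    rw [this]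
    simp [x, smul_smul, h2]
  · rw [hP k (by omega), hP (k - 1) (by omega), hQ k h]
    simp

/-- `dressXi` is bijective. -/
def dressXiEquiv : Equiv.Perm (Op R) :=
  Equiv.ofBijective (dressXi σ δ b) ⟨fun P Q h => by
    rw [← sub_eq_zero, ← (filtered_dressXi σ δ b).map_sub, dressXi_eq_zero_iff] at h
    exact sub_eq_zero.1 h, fun Q => by
      obtain ⟨N, hN⟩ := exists_ordLE Q
      obtain ⟨P, -, hP⟩ := exists_dressXi_eq σ δ b (N := N - 1) (Q := Q) (by simpa using hN)
      exact ⟨P, hP⟩⟩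

/-- The image `ξ^k · 1` of `1` in difference operators. -/
def dressPow (k : ℤ) : Op R := (dressXiEquiv σ δ b ^ k) (mono 0 1)

theorem dressPow_zero : dressPow σ δ b 0 = mono 0 1 := rfl

theorem dressXi_dressPow (k : ℤ) : dressXi σ δ b (dressPow σ δ b k) = dressPow σ δ b (k + 1) := by
  rw [dressPow, dressPow, add_comm, zpow_one_add]; rfl

/-- Stated as an equivalence so that the induction on `ξ^k · 1` also runs towards negative `k`. -/
theorem dressXi_ord_iff (k : ℤ) (P : Op R) :
    OrdLE (k + 1) (dressXi σ δ b P) ∧ IsUnit ((dressXi σ δ b P).1 (k + 1)) ↔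
      OrdLE k P ∧ IsUnit (P.1 k) := by
  have h2 : IsUnit (algebraMap ℝ R √2) := IsUnit.map _ (IsUnit.mk0 _ (by positivity))
  have top : OrdLE k P → (dressXi σ δ b P).1 (k + 1) = algebraMap ℝ R √2 * P.1 k := fun h => by
    simp [coeff_dressXi, h (k + 1) (by omega), Algebra.smul_def]
  have ord : OrdLE (k + 1) (dressXi σ δ b P) ↔ OrdLE k P := by
    refine ⟨fun h => ?_, fun h j hj => ?_⟩
    · obtain ⟨Q, hQ, e⟩ := exists_dressXi_eq σ δ b h
      rwa [(dressXiEquiv σ δ b).injective e] at hQ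
    · simp [coeff_dressXi, h j (by omega), h (j - 1) (by omega)]
  rw [ord]
  refine and_congr_right fun h => ?_
  rw [top h, IsUnit.mul_iff, and_iff_right h2]

theorem dressPow_ord (k : ℤ) :
    OrdLE k (dressPow σ δ b k) ∧ IsUnit ((dressPow σ δ b k).1 k) := by
  induction k using Int.induction_on with
  | zero => exact ⟨ordLE_mono 0 1, by simp [dressPow_zero, coeff_mono]⟩
  | succ i ih => rwa [← dressXi_dressPow, dressXi_ord_iff]
  | pred i ih =>
    rw [← dressXi_ord_iff σ δ b, dressXi_dressPow]
    simpa using ih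

theorem dressPow_ordLE (k : ℤ) : OrdLE (k + 0) (dressPow σ δ b k) := by
  simpa using (dressPow_ord σ δ b k).1

theorem posPart_dressPow (k : ℕ) : posPart (dressPow σ δ b k) = dressPow σ δ b k := by
  rw [posPart_eq_self_iff]
  induction k with
  | zero => intro j hj; exact if_neg (by omega)
  | succ k ih =>
    intro j hj
    push_cast
    rw [← dressXi_dressPow, coeff_dressXi, ih j hj, ih (j - 1) (by omega)]
    simp

/-- The isomorphism `∑ a_k ξ^k ↦ ∑ a_k (ξ^k · 1)` from pseudo-differential to difference
operators. -/
def dress (P : Op R) : Op R := expand (dressPow σ δ b) 0 (dressPow_ordLE σ δ b) P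

theorem filtered_dress : Filtered (dress σ δ b) :=
  filtered_expand (dressPow_ordLE σ δ b)

theorem dress_smul (a : R) (P : Op R) : dress σ δ b (a • P) = a • dress σ δ b P :=
  expand_smul _ _ _

theorem dress_real_smul (c : ℝ) (P : Op R) : dress σ δ b (c • P) = c • dress σ δ b P := by
  have h : ∀ P : Op R, c • P = algebraMap ℝ R c • P := fun P =>
    Op.ext_coeff fun k => by simp [Algebra.smul_def]
  rw [h, h, dress_smul]

theorem dress_mono (k : ℤ) (a : R) : dress σ δ b (mono k a) = a • dressPow σ δ b k :=
  expand_mono _ _ _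

theorem dress_one : dress σ δ b (mono 0 1) = mono 0 1 := by
  rw [dress_mono, one_smul, dressPow_zero]

theorem dress_leftXi (P : Op R) : dress σ δ b (leftXi δ P) = dressXi σ δ b (dress σ δ b P) := by
  refine Filtered.congr_mono ((filtered_dress σ δ b).comp (filtered_leftXi δ))
    ((filtered_dressXi σ δ b).comp (filtered_dress σ δ b)) (fun k a => ?_) P
  simp only [leftXi_mono, (filtered_dress σ δ b).add, dress_mono, dressXi_smul, dressXi_dressPow]

theorem dress_injective {P Q : Op R} (h : dress σ δ b P = dress σ δ b Q) : P = Q := by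
  rw [← sub_eq_zero, ← (filtered_dress σ δ b).map_sub] at h
  exact sub_eq_zero.1 (expand_injective _ (fun k => (dressPow_ord σ δ b k).2) _ h)

theorem exists_dress_eq {N : ℤ} {Q : Op R} (hQ : OrdLE N Q) :
    ∃ P, OrdLE N P ∧ dress σ δ b P = Q :=
  exists_expand_eq _ (fun k => (dressPow_ord σ δ b k).2) hQ

/-- For `k ≥ 0` the operator `ξ^k · 1` has no negative powers of `Λ`; for `k < 0` its order is at
most `k`, so it has no nonnegative ones. -/
theorem dress_posPart (P : Op R) : dress σ δ b (posPart P) = posPart (dress σ δ b P) := by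
  refine Filtered.congr_mono ((filtered_dress σ δ b).comp filtered_posPart)
    (filtered_posPart.comp (filtered_dress σ δ b)) (fun k a => ?_) P
  rcases lt_or_ge k 0 with h | h
  · rw [posPart_eq_zero ((ordLE_mono k a).weaken (by omega)), (filtered_dress σ δ b).map_zero,
      dress_mono, posPart_eq_zero]
    intro j hj
    rw [Op.coeff_smul, (dressPow_ord σ δ b k).1 j (by omega), mul_zero]
  · have h1 : posPart (mono k a) = mono k a := by
      rw [posPart_eq_self_iff]
      exact fun j hj => if_neg (by omega)
    lift k to ℕ using h
    rw [h1, dress_mono, eq_comm, posPart_eq_self_iff]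
    intro j hj
    rw [Op.coeff_smul, (posPart_eq_self_iff _).1 (posPart_dressPow σ δ b k) j hj, mul_zero]

/-- A map from pseudo-differential to difference operators that is `R`-linear, commutes with `ξ`
and vanishes at `1`, vanishes. -/
theorem dress_intertwine {f : Op R → Op R} (hf : Filtered f)
    (hs : ∀ (a : R) P, f (a • P) = a • f P)
    (hc : ∀ P, f (leftXi δ P) = dressXi σ δ b (f P)) (h0 : f (mono 0 1) = 0) (P : Op R) :
    f P = 0 :=
  hf.eq_zero_of_intertwine (θ := leftXi δ) hs
    (fun k => by rw [leftXi_mono]; exact Op.ext_coeff fun n => by simp [coeff_mono])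
    (dressXi_eq_zero_iff σ δ b) hc h0 P

end Dressing

/-! ### Transport of Lax equations along the dressing isomorphism -/

section Transport

variable {R : Type*} [CommRing R] [Algebra ℝ R] (σ : R ≃ₐ[ℝ] R) (δ : Derivation ℝ R R)

theorem posPart_smul (c : ℝ) (P : Op R) : posPart (c • P) = c • posPart P :=
  Op.ext_coeff fun k => by
    simp only [coeff_posPart, Op.coeff_real_smul]
    split_ifs <;> simp

theorem posPart_posPart_mul (P Q : Op R) :
    posPart (lamMul σ (posPart P) (posPart Q)) = lamMul σ (posPart P) (posPart Q) := by
  rw [posPart_eq_self_iff]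
  intro n hn
  change (∑ᶠ i : ℤ, _) = _
  refine finsum_eq_zero_of_forall_eq_zero fun i => ?_
  by_cases hi : 0 ≤ i
  · simp [coeff_posPart, show ¬ i ≤ n by omega]
  · simp [coeff_posPart, hi]

/-- The equation satisfied by an operator passes to its square root. -/
theorem opDeriv_sqrt (hσ : ∀ a, δ (σ a) = σ (δ a)) (hinj : ∀ a, a + σ a = 0 → a = 0)
    {S P : Op R} (hS : OrdLE 1 S) (h1 : S.1 1 = 1) {c : ℝ}
    (h : opDeriv δ (lamMul σ S S) = c • comm (lamMul σ) P (lamMul σ S S)) :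
    opDeriv δ S = c • comm (lamMul σ) P S := by
  have hT : lamMul σ (opDeriv δ S - c • comm (lamMul σ) P S) S +
      lamMul σ S (opDeriv δ S - c • comm (lamMul σ) P S) = 0 := by
    let := differenceRing σ
    have : SMulCommClass ℝ (Op R) (Op R) := ⟨fun c P Q => (lamMul_real_smul σ c P Q).symm⟩
    have : IsScalarTower ℝ (Op R) (Op R) := ⟨fun c P Q => real_smul_lamMul σ c P Q⟩
    rw [opDeriv_lamMul σ δ hσ] at h
    exact anticommutator_defect (A := Op R) h
  rw [← sub_eq_zero]
  -- As `S` has leading term `Λ`, the top coefficient `a` of the defect satisfies `a + σ a = 0`.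
  refine eq_zero_of_top _ fun k hk => hinj _ ?_
  have h2 := congrArg (fun Q : Op R => Q.1 (k + 1)) hT
  simp only [Op.coeff_add, Op.coeff_zero] at h2
  rw [coeff_lamMul_top σ hk hS, add_comm k 1, coeff_lamMul_top σ hS hk, h1, map_one,
    mul_one, one_mul, zpow_one] at h2
  exact h2

theorem opDeriv_one : opDeriv δ (mono 0 1 : Op R) = 0 := by
  rw [opDeriv_mono]
  exact Op.ext_coeff fun k => by simp [coeff_mono]

theorem opDeriv_pow (hσ : ∀ a, δ (σ a) = σ (δ a)) {S P : Op R} {c : ℝ}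
    (h : opDeriv δ S = c • comm (lamMul σ) P S) (n : ℕ) :
    opDeriv δ (pow (lamMul σ) S n) = c • comm (lamMul σ) P (pow (lamMul σ) S n) := by
  rw [pow_eq_npow]
  let := differenceRing σ
  have : SMulCommClass ℝ (Op R) (Op R) := ⟨fun c P Q => (lamMul_real_smul σ c P Q).symm⟩
  have : IsScalarTower ℝ (Op R) (Op R) := ⟨fun c P Q => real_smul_lamMul σ c P Q⟩
  exact derivation_pow (A := Op R) (opDeriv δ) (opDeriv_one δ) (opDeriv_lamMul σ δ hσ) h n

/-- The zero curvature equations implied by Lax equations. -/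
theorem zero_curvature (hσ : ∀ a, δ (σ a) = σ (δ a)) {δt : Derivation ℝ R R} {S : Op R}
    (n : ℕ) {s c : ℝ}
    (hδ : opDeriv δ S = s • comm (lamMul σ) (posPart S) S)
    (ht : opDeriv δt S = c • comm (lamMul σ) (posPart (pow (lamMul σ) S n)) S) :
    s • opDeriv δt (posPart S) - c • opDeriv δ (posPart (pow (lamMul σ) S n)) =
      (s * c) • comm (lamMul σ) (posPart (pow (lamMul σ) S n)) (posPart S) := by
  have hn := opDeriv_pow σ δ hσ hδ n
  have hcomm := pow_mul_comm_self σ S n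
  set T := pow (lamMul σ) S n
  have key : comm (lamMul σ) (posPart T) S - comm (lamMul σ) (posPart S) T =
      comm (lamMul σ) (posPart T) (posPart S) -
        comm (lamMul σ) (T - posPart T) (S - posPart S) := by
    let := differenceRing σ
    exact commutator_truncations (A := Op R) hcomm
  have key2 := congrArg posPart key
  -- Both factors have order at most `-1`, so their commutator has order at most `-2`.
  have hz : posPart (comm (lamMul σ) (T - posPart T) (S - posPart S)) = 0 := by
    apply posPart_eq_zero
    exact OrdLE.weaken
      (((ordLE_sub_posPart T).lamMul σ (ordLE_sub_posPart S)).sub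
        ((ordLE_sub_posPart S).lamMul σ (ordLE_sub_posPart T))) (by norm_num)
  rw [posPart_sub, posPart_sub, hz, sub_zero] at key2
  have hp : posPart (comm (lamMul σ) (posPart T) (posPart S)) =
      comm (lamMul σ) (posPart T) (posPart S) := by
    rw [comm, posPart_sub, posPart_posPart_mul, posPart_posPart_mul]
  rw [hp] at key2
  rw [opDeriv_posPart, opDeriv_posPart, ht, hn, posPart_smul, posPart_smul, ← key2, smul_sub,
    smul_smul, smul_smul, mul_comm c s]

variable {b : R}

/-- The Lax equation for `Y` says exactly that `√2(Λ + b)`, acting from the right, can be moved past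
`Y` at the cost of `δ Y`. -/
theorem dressXi_lamMul (hσ : ∀ a, δ (σ a) = σ (δ a)) {Y : Op R}
    (hY : opDeriv δ Y = √2 • comm (lamMul σ) (mono 1 1 + mono 0 b) Y) (X : Op R) :
    dressXi σ δ b (lamMul σ X Y) = lamMul σ (dressXi σ δ b X) Y := by
  rw [dressXi_eq, dressXi_eq, opDeriv_lamMul σ δ hσ, hY, (filtered_lamMul σ Y).add,
    real_smul_lamMul, lamMul_real_smul, comm, lamMul_sub, lamMul_assoc, lamMul_assoc]
  module

theorem dress_diffMul (hσ : ∀ a, δ (σ a) = σ (δ a)) {Y Y' : Op R}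
    (hY : opDeriv δ Y = √2 • comm (lamMul σ) (mono 1 1 + mono 0 b) Y)
    (hY' : dress σ δ b Y' = Y) (X : Op R) :
    dress σ δ b (diffMul δ (map_zero δ) X Y') = lamMul σ (dress σ δ b X) Y := by
  rw [← sub_eq_zero]
  refine dress_intertwine σ δ b (f := fun X => dress σ δ b (diffMul δ (map_zero δ) X Y') -
    lamMul σ (dress σ δ b X) Y) (((filtered_dress σ δ b).comp (filtered_diffMul δ Y')).sub
      ((filtered_lamMul σ Y).comp (filtered_dress σ δ b))) ?_ ?_ ?_ X
  · intro a P
    rw [smul_diffMul, dress_smul, dress_smul, smul_lamMul, smul_sub]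
  · intro P
    rw [leftXi_diffMul, dress_leftXi, dress_leftXi, (filtered_dressXi σ δ b).map_sub,
      dressXi_lamMul σ δ hσ hY]
  · rw [one_diffMul, dress_one, one_lamMul, hY', sub_self]

theorem dress_pow (hσ : ∀ a, δ (σ a) = σ (δ a)) {Y Y' : Op R}
    (hY : opDeriv δ Y = √2 • comm (lamMul σ) (mono 1 1 + mono 0 b) Y)
    (hY' : dress σ δ b Y' = Y) (n : ℕ) :
    dress σ δ b (pow (diffMul δ (map_zero δ)) Y' n) = pow (lamMul σ) Y n := by
  induction n with
  | zero => exact dress_one σ δ b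
  | succ n ih => rw [pow, dress_diffMul σ δ hσ hY hY', ih, pow]

/-- The dressing isomorphism intertwines the actions of `∂_t`. -/
theorem dress_connection (hσ : ∀ a, δ (σ a) = σ (δ a)) {δt : Derivation ℝ R R}
    (hσt : ∀ a, δt (σ a) = σ (δt a)) (hδt : ∀ a, δt (δ a) = δ (δt a)) {P P' : Op R} {c : ℝ}
    (hP : √2 • opDeriv δt (mono 1 1 + mono 0 b) - c • opDeriv δ P =
      (√2 * c) • comm (lamMul σ) P (mono 1 1 + mono 0 b))
    (hP' : dress σ δ b P' = P) (X : Op R) :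
    dress σ δ b (opDeriv δt X + c • diffMul δ (map_zero δ) X P') =
      opDeriv δt (dress σ δ b X) + c • lamMul σ (dress σ δ b X) P := by
  have hXi : ∀ X, dressXi σ δ b (opDeriv δt X + c • lamMul σ X P) =
      opDeriv δt (dressXi σ δ b X) + c • lamMul σ (dressXi σ δ b X) P := by
    intro X
    have h1 := (filtered_opDeriv δ).add (opDeriv δt X) (c • lamMul σ X P)
    have h2 := (filtered_opDeriv δt).add (opDeriv δ X)
      (√2 • lamMul σ X (mono 1 1 + mono 0 b))
    rw [opDeriv_real_smul, opDeriv_lamMul σ δ hσ] at h1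
    rw [opDeriv_real_smul, opDeriv_lamMul σ δt hσt] at h2
    rw [dressXi_eq, dressXi_eq, h1, h2, opDeriv_comm δ (fun a => (hδt a).symm)]
    let := differenceRing σ
    have : SMulCommClass ℝ (Op R) (Op R) := ⟨fun c P Q => (lamMul_real_smul σ c P Q).symm⟩
    have : IsScalarTower ℝ (Op R) (Op R) := ⟨fun c P Q => real_smul_lamMul σ c P Q⟩
    exact (commuting_connections (A := Op R) hP).symm
  have hB : ∀ X, leftXi δ (opDeriv δt X + c • diffMul δ (map_zero δ) X P') =
      opDeriv δt (leftXi δ X) + c • diffMul δ (map_zero δ) (leftXi δ X) P' := by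
    intro X
    rw [leftXi_diffMul, (filtered_leftXi δ).add]
    refine Op.ext_coeff fun k => ?_
    simp [hδt]
  have fB : Filtered fun X => opDeriv δt X + c • diffMul δ (map_zero δ) X P' :=
    (filtered_opDeriv δt).sum ((filtered_real_smul c).comp (filtered_diffMul δ P'))
  have fA : Filtered fun X => opDeriv δt X + c • lamMul σ X P :=
    (filtered_opDeriv δt).sum ((filtered_real_smul c).comp (filtered_lamMul σ P))
  rw [← sub_eq_zero]
  refine dress_intertwine σ δ b (f := fun X =>
    dress σ δ b (opDeriv δt X + c • diffMul δ (map_zero δ) X P') -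
      (opDeriv δt (dress σ δ b X) + c • lamMul σ (dress σ δ b X) P))
    (((filtered_dress σ δ b).comp fB).sub (fA.comp (filtered_dress σ δ b))) ?_ ?_ ?_ X
  · intro a X
    rw [smul_diffMul, opDeriv_smul, dress_smul, opDeriv_smul, smul_lamMul,
      smul_comm c a, smul_comm c a, add_assoc, add_assoc, ← smul_add, ← smul_add,
      (filtered_dress σ δ b).add, dress_smul, dress_smul, smul_sub]
    abel
  · intro X
    rw [← hB, dress_leftXi, dress_leftXi, ← hXi, (filtered_dressXi σ δ b).map_sub]
  · rw [one_diffMul, dress_one, one_lamMul, opDeriv_one, zero_add, zero_add,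
      dress_real_smul, hP', sub_self]

/-- The Lax equation of `S²` with respect to `t` is transported to pseudo-differential
operators. -/
theorem dress_lax (hσ : ∀ a, δ (σ a) = σ (δ a)) (hinj : ∀ a, a + σ a = 0 → a = 0)
    {S S' : Op R} (hS : OrdLE 1 S) (h1 : S.1 1 = 1)
    (hδ : opDeriv δ (lamMul σ S S) = √2 • comm (lamMul σ) (posPart S) (lamMul σ S S))
    (hS' : dress σ δ (S.1 0) S' = S) {δt : Derivation ℝ R R}
    (hσt : ∀ a, δt (σ a) = σ (δt a)) (hδt : ∀ a, δt (δ a) = δ (δt a)) (n : ℕ) {c : ℝ}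
    (ht : opDeriv δt (lamMul σ S S) =
      c • comm (lamMul σ) (posPart (pow (lamMul σ) S n)) (lamMul σ S S)) :
    opDeriv δt (diffMul δ (map_zero δ) S' S') =
      c • comm (diffMul δ (map_zero δ)) (posPart (pow (diffMul δ (map_zero δ)) S' n))
        (diffMul δ (map_zero δ) S' S') := by
  have flatS := opDeriv_sqrt σ δ hσ hinj hS h1 hδ
  have tS := opDeriv_sqrt σ δt hσt hinj hS h1 ht
  have zc := zero_curvature σ δ hσ n flatS tS
  rw [posPart_of_ordLE_one hS h1] at flatS hδ zc
  have hP' : dress σ δ (S.1 0) (posPart (pow (diffMul δ (map_zero δ)) S' n)) =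
      posPart (pow (lamMul σ) S n) := by
    rw [dress_posPart, dress_pow σ δ hσ flatS hS']
  have hL' : dress σ δ (S.1 0) (diffMul δ (map_zero δ) S' S') = lamMul σ S S := by
    rw [dress_diffMul σ δ hσ flatS hS', hS']
  have con := dress_connection σ δ hσ hσt hδt zc hP' (diffMul δ (map_zero δ) S' S')
  rw [hL', ht, (filtered_dress σ δ _).add, dress_real_smul] at con
  apply dress_injective σ δ (S.1 0)
  -- `P` need not satisfy the `δ`-Lax equation, so the image of `L' P'` is not computed; it occurs
  -- in `con` and in the goal, and cancels.
  rw [dress_real_smul, comm, (filtered_dress σ δ _).map_sub, dress_diffMul σ δ hσ hδ hL', hP',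
    eq_sub_of_add_eq con, comm]
  module

end Transport

/-! ### The Lax operator of the constrained KP hierarchy -/

section LaxOperator

variable {R : Type*} [CommRing R] [Algebra ℝ R] (σ : R ≃ₐ[ℝ] R) (δ : Derivation ℝ R R) {b : R}

theorem dressXi_mono (k : ℤ) (a : R) :
    dressXi σ δ b (mono k a) =
      mono (k + 1) (√2 • a) + mono k (δ a + √2 • (a * (σ ^ k) b)) := by
  refine Op.ext_coeff fun n => ?_
  simp only [coeff_dressXi, Op.coeff_add, coeff_mono, sub_eq_iff_eq_add]
  by_cases h : n = k
  · subst h; simp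
  · by_cases h' : n = k + 1 <;> simp [h, h']

theorem dressPow_succ {k m : ℤ} (h : m = k + 1) :
    dressPow σ δ b m = dressXi σ δ b (dressPow σ δ b k) := by
  rw [h, dressXi_dressPow]

/-- Compare the coefficients of `Λ³, …, Λ⁰`. The first two agree by `z3` and `u + w = b + σ b`;
those of `Λ` and `1` account for the formulas for `z2` and `z1`. -/
theorem dress_constrained_normal_form {u v w z1 z2 z3 : R}
    (hb : b + σ b = u + w)
    (hz3 : z3 = √2 • (b + σ w))
    (hz2 : z2 = σ w * (b + σ b) - σ b * σ b + σ v - (1 / √2) • (δ (σ b) + 2 * δ b))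
    (hz1 : z1 = √2 • (σ w * (σ w * (b + σ b) + b * b - σ b * σ b + σ v))
      + (2 * σ b * δ (σ b) - 2 * b * δ b - (b + σ b) * δ (σ w) - 2 * σ w * δ (b + σ b) - δ (σ v))
      + (1 / √2) • δ (δ (b + σ b))) :
    √2 • (mono 3 1 + mono 2 (σ u) + mono 1 (σ v)) =
      dress σ δ b (leftXi δ (mono 2 (algebraMap ℝ R (1 / 2)) + mono 0 z2)
        - z3 • (mono 2 (algebraMap ℝ R (1 / 2)) + mono 0 z2) + mono 0 z1) := by
  have e1 : dressPow σ δ b 1 = _ := dressPow_succ σ δ (k := 0) rfl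
  have e2 : dressPow σ δ b 2 = _ := dressPow_succ σ δ (k := 1) rfl
  have e3 : dressPow σ δ b 3 = _ := dressPow_succ σ δ (k := 2) rfl
  rw [dressPow_zero, dressXi_mono] at e1
  rw [e1, (filtered_dressXi σ δ b).add, dressXi_mono, dressXi_mono] at e2
  rw [e2, (filtered_dressXi σ δ b).add, (filtered_dressXi σ δ b).add,
    (filtered_dressXi σ δ b).add, dressXi_mono, dressXi_mono, dressXi_mono, dressXi_mono] at e3
  obtain rfl : u = b + σ b - w := eq_sub_of_add_eq hb.symm
  have hr : algebraMap ℝ R √2 * algebraMap ℝ R √2 = 2 := by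
    rw [← map_mul, Real.mul_self_sqrt (by norm_num), map_ofNat]
  have hh : algebraMap ℝ R (1 / 2) * 2 = 1 := by
    rw [← map_ofNat (algebraMap ℝ R) 2, ← map_mul]; norm_num
  have hi : algebraMap ℝ R (√2)⁻¹ = algebraMap ℝ R √2 * algebraMap ℝ R (1 / 2) := by
    rw [← map_mul]
    congr 1
    field_simp
    norm_num
  have hd2 : δ 2 = 0 := by
    have := δ.map_natCast 2
    rwa [Nat.cast_ofNat] at this
  have hσσ : (σ ^ (2 : ℤ)) b = σ (σ b) := rfl
  rw [(filtered_dress σ δ b).add, (filtered_dress σ δ b).map_sub, dress_leftXi, dress_smul,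
    (filtered_dress σ δ b).add, dress_mono, dress_mono, dress_mono, (filtered_dressXi σ δ b).add,
    dressXi_smul, dressXi_smul, ← dressPow_succ σ δ (k := 2) (m := 3) rfl,
    ← dressPow_succ σ δ (k := 0) (m := 1) rfl, e3, e2, e1, dressPow_zero]
  refine Op.ext_coeff fun n => ?_
  subst hz3
  simp only [Op.coeff_add, Op.coeff_sub, Op.coeff_smul, Op.coeff_real_smul, coeff_mono]
  norm_num
  have ha : ∀ (r : ℝ) (x : R), r • x = algebraMap ℝ R r * x := Algebra.smul_def
  by_cases h0 : n = 0
  · subst h0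
    norm_num [hd2, hσσ, ha, hi, hz2, hz1]
    clear e1 e2 e3 hz2 hz1 hd2 hσσ ha hb
    grind
  by_cases h1 : n = 1
  · subst h1
    norm_num [hd2, hσσ, ha, hi, hz2, hz1]
    clear e1 e2 e3 hz2 hz1 hd2 hσσ ha hb
    grind
  by_cases h2 : n = 2
  · subst h2
    norm_num [hd2, hσσ, ha, hi, hz2, hz1]
    clear e1 e2 e3 hz2 hz1 hd2 hσσ ha hb
    grind
  by_cases h3 : n = 3
  · subst h3
    norm_num [hd2, hσσ, ha, hi, hz2, hz1]
    clear e1 e2 e3 hz2 hz1 hd2 hσσ ha hb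
    grind
  simp [h0, h1, h2, h3]

theorem eq_constrained_lax {u v w z1 z2 z3 : R}
    (hb : b + σ b = u + w)
    (hz3 : z3 = √2 • (b + σ w))
    (hz2 : z2 = σ w * (b + σ b) - σ b * σ b + σ v - (1 / √2) • (δ (σ b) + 2 * δ b))
    (hz1 : z1 = √2 • (σ w * (σ w * (b + σ b) + b * b - σ b * σ b + σ v))
      + (2 * σ b * δ (σ b) - 2 * b * δ b - (b + σ b) * δ (σ w) - 2 * σ w * δ (b + σ b) - δ (σ v))
      + (1 / √2) • δ (δ (b + σ b)))
    {L L' : Op R}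
    (hL : lamMul σ (mono 0 1 - mono (-1) w) L = mono 2 1 + mono 1 u + mono 0 v)
    (hδ : opDeriv δ L = √2 • comm (lamMul σ) (mono 1 1 + mono 0 b) L)
    (hL' : dress σ δ b L' = L) :
    L' = mono 2 (algebraMap ℝ R (1 / 2)) + mono 0 z2 +
      diffMul δ (map_zero δ) (invXiSub δ z3) (mono 0 z1) := by
  have hXi : dressXi σ δ b L = √2 • lamMul σ (mono 1 1 + mono 0 b) L := by
    rw [dressXi_eq, hδ, comm]; module
  -- Multiply `hL` on the left by `Λ`, using `Λ(1 - wΛ⁻¹) = Λ - σ(w)`.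
  have hΛ : lamMul σ (mono 1 1) L - lamMul σ (mono 0 (σ w)) L =
      mono 3 1 + mono 2 (σ u) + mono 1 (σ v) := by
    have h := congrArg (lamMul σ (mono 1 1)) hL
    rw [← lamMul_assoc, lamMul_sub, lamMul_add, lamMul_add] at h
    simp only [mono_lamMul_mono, (filtered_lamMul σ L).map_sub] at h
    simpa using h
  have key : leftXi δ L' - z3 • L' =
      leftXi δ (mono 2 (algebraMap ℝ R (1 / 2)) + mono 0 z2)
        - z3 • (mono 2 (algebraMap ℝ R (1 / 2)) + mono 0 z2) + mono 0 z1 := by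
    apply dress_injective σ δ b
    rw [← dress_constrained_normal_form σ δ hb hz3 hz2 hz1, ← hΛ, (filtered_dress σ δ b).map_sub,
      dress_leftXi, dress_smul, hL', hXi, (filtered_lamMul σ L).add, hz3]
    refine Op.ext_coeff fun n => ?_
    simp only [coeff_mono_lamMul, Op.coeff_real_smul, Op.coeff_add, Op.coeff_sub,
      Op.coeff_smul, zpow_zero, sub_zero, AlgEquiv.one_apply, Algebra.smul_def]
    ring
  rw [← sub_eq_zero]
  refine leftXi_sub_smul_injective δ z3 _ ?_
  have h := leftXi_invXiSub_diffMul δ z3 (mono 0 z1)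
  rw [← sub_eq_zero] at key h
  rw [(filtered_leftXi δ).map_sub, (filtered_leftXi δ).add (_ + _)]
  rw [← sub_zero (0 : Op R)]
  nth_rw 1 [← key]
  rw [← h]
  module

end LaxOperator

/-! ### The shift operator `exp(ε ∂ₓ)` is an automorphism -/

section Shift

variable {F : Type*} [CommRing F] [Algebra ℝ F] (d : Derivation ℝ F F)

open Finset.HasAntidiagonal in
theorem coeff_applySeries (p : ℝ⟦X⟧) (f : F⟦X⟧) (n : ℕ) :
    PowerSeries.coeff n (applySeries d p f) = ∑ ij ∈ antidiagonal n,
      PowerSeries.coeff ij.1 p • (⇑d)^[ij.1] (PowerSeries.coeff ij.2 f) :=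
  PowerSeries.coeff_mk _ _

theorem coeff_deriv (f : F⟦X⟧) (n : ℕ) :
    PowerSeries.coeff n (deriv d f) = d (PowerSeries.coeff n f) :=
  PowerSeries.coeff_mk _ _

theorem applySeries_add (p : ℝ⟦X⟧) (f g : F⟦X⟧) :
    applySeries d p (f + g) = applySeries d p f + applySeries d p g := by
  ext n
  simp only [coeff_applySeries, map_add, iterate_map_add, smul_add, Finset.sum_add_distrib]

theorem add_applySeries (p q : ℝ⟦X⟧) (f : F⟦X⟧) :
    applySeries d (p + q) f = applySeries d p f + applySeries d q f := by
  ext n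
  simp only [coeff_applySeries, map_add, add_smul, Finset.sum_add_distrib]

theorem iterate_smul (c : ℝ) (i : ℕ) (a : F) : (⇑d)^[i] (c • a) = c • (⇑d)^[i] a := by
  induction i generalizing a with
  | zero => rfl
  | succ i ih => rw [Function.iterate_succ_apply, d.map_smul, ih, Function.iterate_succ_apply]

theorem iterate_sum {ι : Type*} (s : Finset ι) (g : ι → F) (i : ℕ) :
    (⇑d)^[i] (∑ j ∈ s, g j) = ∑ j ∈ s, (⇑d)^[i] (g j) := by
  induction i with
  | zero => rfl
  | succ i ih => simp only [Function.iterate_succ_apply', ih, map_sum]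

/-- Functional calculus in `ε d`: the exponential law for shifts and the inverse of `Λ + 1` become
identities between real power series. -/
theorem applySeries_mul (p q : ℝ⟦X⟧) (f : F⟦X⟧) :
    applySeries d (p * q) f = applySeries d p (applySeries d q f) := by
  ext n
  simp only [coeff_applySeries, PowerSeries.coeff_mul, Finset.sum_smul, iterate_sum,
    Finset.smul_sum, iterate_smul, smul_smul, ← Function.iterate_add_apply]
  rw [Finset.sum_sigma', Finset.sum_sigma']
  refine Finset.sum_nbij' (fun x => ⟨(x.2.1, x.2.2 + x.1.2), (x.2.2, x.1.2)⟩)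
    (fun x => ⟨(x.1.1 + x.2.1, x.2.2), (x.1.1, x.2.1)⟩) ?_ ?_ ?_ ?_ ?_
  · rintro ⟨⟨a, b⟩, ⟨k, l⟩⟩ h
    simp only [Finset.mem_sigma, Finset.HasAntidiagonal.mem_antidiagonal, and_true] at h ⊢
    omega
  · rintro ⟨⟨a, b⟩, ⟨k, l⟩⟩ h
    simp only [Finset.mem_sigma, Finset.HasAntidiagonal.mem_antidiagonal, and_true] at h ⊢
    omega
  · rintro ⟨⟨a, b⟩, ⟨k, l⟩⟩ h
    simp only [Finset.mem_sigma, Finset.HasAntidiagonal.mem_antidiagonal] at h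
    obtain ⟨h1, rfl⟩ := h
    rfl
  · rintro ⟨⟨a, b⟩, ⟨k, l⟩⟩ h
    simp only [Finset.mem_sigma, Finset.HasAntidiagonal.mem_antidiagonal] at h
    obtain ⟨h1, rfl⟩ := h
    rfl
  · rintro ⟨⟨a, b⟩, ⟨k, l⟩⟩ h
    simp only [Finset.mem_sigma, Finset.HasAntidiagonal.mem_antidiagonal] at h
    obtain ⟨h1, rfl⟩ := h
    rfl

theorem applySeries_of_constant (p : ℝ⟦X⟧) {f : F⟦X⟧}
    (hf : ∀ n, d (PowerSeries.coeff n f) = 0) :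
    applySeries d p f = PowerSeries.coeff 0 p • f := by
  ext n
  rw [coeff_applySeries, Finset.sum_eq_single (0, n)]
  · simp
  · rintro ⟨i, j⟩ hij hne
    obtain _ | i := i
    · simp only [Finset.HasAntidiagonal.mem_antidiagonal, zero_add] at hij
      exact absurd (by simp [hij]) hne
    · simp [hf]
  · simp

theorem applySeries_one (f : F⟦X⟧) : applySeries d 1 f = f := by
  ext n
  rw [coeff_applySeries, Finset.sum_eq_single (0, n)]
  · simp
  · rintro ⟨i, j⟩ hij hne
    obtain _ | i := i
    · simp only [Finset.HasAntidiagonal.mem_antidiagonal, zero_add] at hij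
      exact absurd (by simp [hij]) hne
    · simp [PowerSeries.coeff_one]
  · simp

theorem shift_eq (i : ℤ) (f : F⟦X⟧) :
    shift d i f = applySeries d (PowerSeries.rescale (i : ℝ) (PowerSeries.exp ℝ)) f := by
  rw [shift]
  congr 1
  ext n
  simp [PowerSeries.coeff_exp, div_eq_mul_inv]

theorem shift_add_index (i j : ℤ) (f : F⟦X⟧) : shift d (i + j) f = shift d i (shift d j f) := by
  rw [shift_eq, shift_eq, shift_eq, ← applySeries_mul, PowerSeries.exp_mul_exp_eq_exp_add]
  push_cast
  rfl

theorem shift_zero_index (f : F⟦X⟧) : shift d 0 f = f := by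
  rw [shift_eq]
  simp [applySeries_one]

theorem shift_of_constant (i : ℤ) {f : F⟦X⟧} (hf : ∀ n, d (PowerSeries.coeff n f) = 0) :
    shift d i f = f := by
  rw [shift_eq, applySeries_of_constant d _ hf]
  simp

/-- The Leibniz rule for `dⁿ / n!`. -/
theorem divided_iterate_mul (c : ℝ) (n : ℕ) (a b : F) :
    (c ^ n / (n ! : ℝ)) • (⇑d)^[n] (a * b) =
      ∑ ij ∈ Finset.HasAntidiagonal.antidiagonal n,
        ((c ^ ij.1 / (ij.1 ! : ℝ)) • (⇑d)^[ij.1] a) *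
          ((c ^ ij.2 / (ij.2 ! : ℝ)) • (⇑d)^[ij.2] b) := by
  let T : ℕ → F → F := fun i a => (c ^ i / (i ! : ℝ)) • (⇑d)^[i] a
  -- The divided powers satisfy `c d T_i = (i+1) T_{i+1}`; after Leibniz, the weights `i` and `j` of
  -- each term `T_i a · T_j b` add up to `n + 1`.
  have hT : ∀ i a, c • d (T i a) = ((i : ℝ) + 1) • T (i + 1) a := by
    intro i a
    simp only [T, d.map_smul, Function.iterate_succ_apply', smul_smul, Nat.factorial_succ]
    congr 1
    push_cast
    field_simp
    ring
  change T n (a * b) = ∑ ij ∈ Finset.HasAntidiagonal.antidiagonal n, T ij.1 a * T ij.2 b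
  induction n with
  | zero => simp [T]
  | succ n ih =>
    have h := hT n (a * b)
    rw [ih, map_sum, Finset.smul_sum] at h
    have h2 : ∀ ij ∈ Finset.HasAntidiagonal.antidiagonal n, c • d (T ij.1 a * T ij.2 b) =
        ((ij.2 : ℝ) + 1) • (T ij.1 a * T (ij.2 + 1) b) +
          ((ij.1 : ℝ) + 1) • (T (ij.1 + 1) a * T ij.2 b) := by
      intro ij _
      rw [Derivation.leibniz, smul_add, smul_eq_mul, smul_eq_mul, ← mul_smul_comm, hT,
        ← mul_smul_comm, hT, mul_smul_comm, mul_smul_comm (_ : ℝ) (T ij.2 b),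
        mul_comm (T ij.2 b)]
    rw [Finset.sum_congr rfl h2, Finset.sum_add_distrib] at h
    have h3 : ∑ ij ∈ Finset.HasAntidiagonal.antidiagonal (n + 1),
        (ij.2 : ℝ) • (T ij.1 a * T ij.2 b) = ∑ ij ∈ Finset.HasAntidiagonal.antidiagonal n,
          ((ij.2 : ℝ) + 1) • (T ij.1 a * T (ij.2 + 1) b) := by
      rw [Finset.Nat.sum_antidiagonal_succ']
      simp
    have h4 : ∑ ij ∈ Finset.HasAntidiagonal.antidiagonal (n + 1),
        (ij.1 : ℝ) • (T ij.1 a * T ij.2 b) = ∑ ij ∈ Finset.HasAntidiagonal.antidiagonal n,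
          ((ij.1 : ℝ) + 1) • (T (ij.1 + 1) a * T ij.2 b) := by
      rw [Finset.Nat.sum_antidiagonal_succ]
      simp
    rw [← h3, ← h4, ← Finset.sum_add_distrib] at h
    have h5 : ∀ ij ∈ Finset.HasAntidiagonal.antidiagonal (n + 1),
        (ij.2 : ℝ) • (T ij.1 a * T ij.2 b) + (ij.1 : ℝ) • (T ij.1 a * T ij.2 b) =
          ((n : ℝ) + 1) • (T ij.1 a * T ij.2 b) := by
      intro ij hij
      rw [Finset.HasAntidiagonal.mem_antidiagonal] at hij
      rw [← add_smul]
      congr 1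
      exact_mod_cast (add_comm _ _).trans hij
    rw [Finset.sum_congr rfl h5, ← Finset.smul_sum] at h
    have hn : (n : ℝ) + 1 ≠ 0 := by positivity
    have := congrArg (fun x => ((n : ℝ) + 1)⁻¹ • x) h
    simpa only [smul_smul, inv_mul_cancel₀ hn, one_smul, eq_comm] using this

/-- The exponential of a derivation is multiplicative. Both sides sum over two derivative orders and
two `ε`-degrees, grouped differently. -/
theorem shift_mul (i : ℤ) (f g : F⟦X⟧) : shift d i (f * g) = shift d i f * shift d i g := by
  ext n
  simp only [shift, coeff_applySeries, PowerSeries.coeff_mul, PowerSeries.coeff_mk, iterate_sum,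
    Finset.smul_sum, divided_iterate_mul, Finset.sum_mul_sum]
  simp only [Finset.sum_sigma']
  refine Finset.sum_nbij'
    (fun x => ⟨(x.2.2.1 + x.2.1.1, x.2.2.2 + x.2.1.2), ⟨(x.2.2.1, x.2.1.1), (x.2.2.2, x.2.1.2)⟩⟩)
    (fun x => ⟨(x.2.1.1 + x.2.2.1, x.2.1.2 + x.2.2.2), ⟨(x.2.1.2, x.2.2.2), (x.2.1.1, x.2.2.1)⟩⟩)
    ?_ ?_ ?_ ?_ ?_
  · rintro ⟨⟨a, b⟩, ⟨⟨k, l⟩, ⟨r, s⟩⟩⟩ h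
    simp only [Finset.mem_sigma, Finset.HasAntidiagonal.mem_antidiagonal, and_true] at h ⊢
    omega
  · rintro ⟨⟨a, b⟩, ⟨⟨k, l⟩, ⟨r, s⟩⟩⟩ h
    simp only [Finset.mem_sigma, Finset.HasAntidiagonal.mem_antidiagonal, and_true] at h ⊢
    omega
  · rintro ⟨⟨a, b⟩, ⟨⟨k, l⟩, ⟨r, s⟩⟩⟩ h
    simp only [Finset.mem_sigma, Finset.HasAntidiagonal.mem_antidiagonal] at h
    obtain ⟨h1, rfl, rfl⟩ := h
    rfl
  · rintro ⟨⟨a, b⟩, ⟨⟨k, l⟩, ⟨r, s⟩⟩⟩ h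
    simp only [Finset.mem_sigma, Finset.HasAntidiagonal.mem_antidiagonal] at h
    obtain ⟨h1, rfl, rfl⟩ := h
    rfl
  · rintro ⟨⟨a, b⟩, ⟨⟨k, l⟩, ⟨r, s⟩⟩⟩ h
    rfl

/-- The shift `Λ = exp(ε ∂ₓ)` as an automorphism of `F⟦ε⟧`. -/
def shiftEquiv : F⟦X⟧ ≃ₐ[ℝ] F⟦X⟧ where
  toFun := shift d 1
  invFun := shift d (-1)
  left_inv f := by rw [← shift_add_index, neg_add_cancel, shift_zero_index]
  right_inv f := by rw [← shift_add_index, add_neg_cancel, shift_zero_index]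
  map_mul' := shift_mul d 1
  map_add' f g := by rw [shift_eq, shift_eq, shift_eq, applySeries_add]
  commutes' r := by
    refine shift_of_constant d 1 fun n => ?_
    rw [Algebra.algebraMap_eq_smul_one, PowerSeries.coeff_smul, d.map_smul, PowerSeries.coeff_one]
    split_ifs <;> simp

theorem shiftEquiv_apply (f : F⟦X⟧) : shiftEquiv d f = shift d 1 f := rfl

theorem shiftEquiv_zpow_apply (i : ℤ) (f : F⟦X⟧) : (shiftEquiv d ^ i) f = shift d i f := by
  induction i using Int.induction_on generalizing f with
  | zero => rw [zpow_zero, shift_zero_index]; rfl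
  | succ i ih => rw [zpow_add_one, AlgEquiv.mul_apply, ih, shiftEquiv_apply, shift_add_index]
  | pred i ih =>
    rw [zpow_sub_one, AlgEquiv.mul_apply, ih, sub_eq_add_neg, shift_add_index]
    rfl

theorem shiftMul_eq : shiftMul d = lamMul (shiftEquiv d) := by
  funext P Q
  refine Op.ext_coeff fun n => ?_
  exact finsum_congr fun i => by rw [shiftEquiv_zpow_apply]

theorem shiftEquiv_add_self (f : F⟦X⟧) :
    f + shiftEquiv d f = applySeries d (PowerSeries.exp ℝ + 1) f := by
  rw [add_applySeries, applySeries_one, shiftEquiv_apply, shift_eq, add_comm]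
  simp

theorem exp_add_one_mul_inv :
    (PowerSeries.exp ℝ + 1) * (PowerSeries.exp ℝ + 1)⁻¹ = (1 : ℝ⟦X⟧) :=
  PowerSeries.mul_inv_cancel _ (by simp)

theorem invShiftAddOne_add_shift (f : F⟦X⟧) :
    invShiftAddOne d f + shiftEquiv d (invShiftAddOne d f) = f := by
  rw [shiftEquiv_add_self, invShiftAddOne, ← applySeries_mul, exp_add_one_mul_inv,
    applySeries_one]

/-- `exp + 1` has constant term `2`, so it is an invertible power series. -/
theorem add_shiftEquiv_injective (f : F⟦X⟧) (h : f + shiftEquiv d f = 0) : f = 0 := by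
  rw [shiftEquiv_add_self] at h
  have h2 := applySeries_mul d (PowerSeries.exp ℝ + 1)⁻¹ (PowerSeries.exp ℝ + 1) f
  rw [mul_comm, exp_add_one_mul_inv, applySeries_one, h] at h2
  rw [h2]
  ext n
  simp [coeff_applySeries, iterate_map_zero d]

/-! ### The derivation `ε d` and its compatibility with the shift -/

theorem deriv_mul (f g : F⟦X⟧) : deriv d (f * g) = f * deriv d g + deriv d f * g := by
  ext n
  simp only [coeff_deriv, PowerSeries.coeff_mul, map_sum, map_add, Derivation.leibniz,
    Finset.sum_add_distrib, smul_eq_mul]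
  congr 1
  exact Finset.sum_congr rfl fun _ _ => mul_comm _ _

theorem deriv_eps_mul (f : F⟦X⟧) : deriv d (eps * f) = eps * deriv d f := by
  have : deriv d (eps : F⟦X⟧) = 0 := by
    ext n
    rw [coeff_deriv, eps, PowerSeries.coeff_X]
    split_ifs <;> simp
  rw [deriv_mul, this, zero_mul, add_zero]

/-- The derivation `ε d` of `F⟦ε⟧`. -/
def epsDeriv : Derivation ℝ F⟦X⟧ F⟦X⟧ :=
  Derivation.mk'
    { toFun := fun f => eps * deriv d f
      map_add' := fun f g => by
        rw [← mul_add]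
        congr 1
        ext n
        simp [coeff_deriv]
      map_smul' := fun c f => by
        rw [RingHom.id_apply, ← mul_smul_comm]
        congr 1
        ext n
        simp [coeff_deriv] }
    fun f g => by
      change eps * deriv d (f * g) = f * (eps * deriv d g) + g * (eps * deriv d f)
      rw [deriv_mul]
      ring

theorem epsDeriv_apply (f : F⟦X⟧) : epsDeriv d f = eps * deriv d f := rfl

theorem epsDeriv_comm {d' : Derivation ℝ F F} (h : ∀ a, d (d' a) = d' (d a)) (f : F⟦X⟧) :
    epsDeriv d (epsDeriv d' f) = epsDeriv d' (epsDeriv d f) := by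
  simp only [epsDeriv_apply, deriv_eps_mul]
  congr 2
  ext n
  simp [coeff_deriv, h]

theorem epsDeriv_shiftEquiv {d' : Derivation ℝ F F} (h : ∀ a, d' (d a) = d (d' a)) (f : F⟦X⟧) :
    epsDeriv d' (shiftEquiv d f) = shiftEquiv d (epsDeriv d' f) := by
  have hX : shiftEquiv d (eps : F⟦X⟧) = eps := by
    refine shift_of_constant d 1 fun n => ?_
    rw [eps, PowerSeries.coeff_X]
    split_ifs <;> simp
  rw [epsDeriv_apply, epsDeriv_apply, map_mul, hX]
  congr 1
  have hi : ∀ (i : ℕ) a, d' ((⇑d)^[i] a) = (⇑d)^[i] (d' a) := by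
    intro i
    induction i with
    | zero => exact fun _ => rfl
    | succ i ih => intro a; rw [Function.iterate_succ_apply, ih, h, Function.iterate_succ_apply]
  ext n
  rw [shiftEquiv_apply, shiftEquiv_apply, coeff_deriv, shift, shift, coeff_applySeries,
    coeff_applySeries, map_sum]
  exact Finset.sum_congr rfl fun ij _ => by rw [d'.map_smul, hi, coeff_deriv]

theorem eps_smul_derivOp (P : Op F⟦X⟧) : (eps : F⟦X⟧) • derivOp d P = opDeriv (epsDeriv d) P := rfl

end Shift

end RationalToda

end

/-- `F` is any commutative real algebra of functions of `x` and of all times `t^{2,k}`, `t^{3,k}`,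
with its commuting partial derivatives `D i`; `u`, `v`, `w` are power series in `ε` over `F`. -/
theorem mainTheorem8 {F : Type*} [CommRing F] [Algebra ℝ F]
    (D : RationalToda.Var → Derivation ℝ F F)
    (hD : ∀ (i j : RationalToda.Var) (f : F), D i (D j f) = D j (D i f))
    (u v w : PowerSeries F)
    (h : RationalToda.SolvesRR2T D u v w) :
    RationalToda.SolvesCKP D
      (RationalToda.zTilde1 D u v w)
      (RationalToda.zTilde2 D u v w)
      (RationalToda.zTilde3 D u w) := by
  open RationalToda in
  obtain ⟨S, ⟨h1, hS, hSS⟩, ht2, ht3⟩ := h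
  have hS : OrdLE 1 S := hS
  have hL : shiftMul (D .x) (mono 0 1 - mono (-1) w) (laxToda (D .x) u v w) =
      mono 2 1 + mono 1 u + mono 0 v := by
    rw [laxToda]
    have := shiftMul_invOneSub (D .x) w
    rw [shiftMul_eq] at this ⊢
    rw [← lamMul_assoc, this, one_lamMul]
  rw [shiftMul_eq] at hSS ht2 ht3 hL
  simp only [eps_smul_derivOp] at ht2 ht3
  set σ := shiftEquiv (D .x) with hσdef
  set δ := epsDeriv (D (.t2 0)) with hδdef
  have hσ : ∀ i a, epsDeriv (D i) (σ a) = σ (epsDeriv (D i) a) :=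
    fun i => epsDeriv_shiftEquiv _ (hD _ _)
  have hinj := add_shiftEquiv_injective (D .x)
  have hb : bFun D u w + σ (bFun D u w) = u + w := invShiftAddOne_add_shift (D .x) (u + w)
  rw [← hSS] at ht2 ht3 hL
  -- The coefficient of `Λ` in `hL` reads `S₀ + σ S₀ - w = u`, an equation whose only solution is
  -- `b`.
  have hb0 : S.1 0 = bFun D u w := by
    have e1 := coeff_lamMul_second σ hS hS
    have e2 := coeff_lamMul_top σ hS hS
    have e3 := congrArg (fun P => P.1 1) hL
    simp only [(filtered_lamMul σ _).map_sub, Op.coeff_sub, Op.coeff_add, coeff_mono_lamMul,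
      coeff_mono] at e3
    norm_num at e1 e2 e3
    rw [h1, map_one, mul_one] at e2
    rw [e2, map_one, mul_one, e1, h1, mul_one, one_mul] at e3
    rw [← sub_eq_zero]
    refine hinj _ ?_
    change _ + σ (S.1 0 - bFun D u w) = _
    rw [map_sub]
    linear_combination e3 - hb
  have hδ : opDeriv δ (lamMul σ S S) =
      √2 • comm (lamMul σ) (posPart S) (lamMul σ S S) := by
    have := ht2 0
    rwa [show pow (lamMul σ) S (2 * 0 + 1) = S from one_lamMul σ S,
      show (2 : ℝ) ^ (((0 : ℕ) : ℝ) + 1 / 2) / ((2 * 0 + 1)‼ : ℕ) = √2 by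
        rw [Real.sqrt_eq_rpow]; simp] at this
  have flatS := opDeriv_sqrt σ δ (hσ _) hinj hS h1 hδ
  have flatL := hδ
  rw [posPart_of_ordLE_one hS h1] at flatS flatL
  obtain ⟨S', hS'ord, hS'⟩ := exists_dress_eq σ δ (S.1 0) hS
  have hL' : dress σ δ (S.1 0) (diffMul δ (map_zero δ) S' S') = lamMul σ S S := by
    rw [dress_diffMul σ δ (hσ _) flatS hS', hS']
  have hlax : diffMul δ (map_zero δ) S' S' =
      laxCKP (D (.t2 0)) (zTilde1 D u v w) (zTilde2 D u v w) (zTilde3 D u w) := by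
    rw [hb0] at flatL hL'
    refine eq_constrained_lax σ δ (b := bFun D u w) hb rfl ?_ ?_ hL flatL hL'
    · simp only [zTilde2, hδdef, epsDeriv_apply, hσdef, shiftEquiv_apply]
      ring_nf
    · simp only [zTilde1, hδdef, epsDeriv_apply, hσdef, shiftEquiv_apply, deriv_eps_mul]
      ring_nf
  -- The integer powers of `L'` are even powers of `S'`, so both families of flows fall under one
  -- transport statement.
  have hpow : ∀ n, pow (diffMul δ (map_zero δ)) (diffMul δ (map_zero δ) S' S') n =
      pow (diffMul δ (map_zero δ)) S' (2 * n) := by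
    intro n
    apply dress_injective σ δ (S.1 0)
    rw [dress_pow σ δ (hσ _) flatL hL', dress_pow σ δ (hσ _) flatS hS', pow_sq]
  have transport := fun i => dress_lax σ δ (hσ _) hinj hS h1 hδ hS' (δt := epsDeriv (D i)) (hσ i)
    (epsDeriv_comm _ (hD _ _))
  refine ⟨S', ⟨?_, hS'ord, hlax⟩, fun k => ?_, fun k => ?_⟩
  -- The leading coefficient of `ξ · 1` is `√2` and that of `S` is `1`, so that of `S'` is `1/√2`.
  · have e := coeff_expand_top (dressPow_ordLE σ δ (S.1 0)) hS'ord
    have e1 : (dressPow σ δ (S.1 0) 1).1 1 = √2 • 1 := by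
      rw [dressPow_succ σ δ (k := 0) (m := 1) rfl, dressPow_zero, dressXi_mono]
      simp [coeff_mono]
    change (dress σ δ (S.1 0) S').1 1 = _ at e
    rw [hS', h1, e1] at e
    have h2 : √2 ≠ 0 := by positivity
    rw [Algebra.algebraMap_eq_smul_one, e, mul_smul_comm, mul_one, smul_smul,
      one_div_mul_cancel h2, one_smul]
  · rw [← hlax]
    exact transport _ _ (ht2 k)
  · rw [← hlax]
    have := ht3 k
    rw [pow_sq] at this
    have := transport _ _ this
    rw [← hpow] at this
    exact this
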